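/- **Theorem 3.2 (invariant form of the Bonnet theorem).** All functions and surfaces are smooth ($C^\infty$), and subscripts $u,v$ denote partial derivatives. Consider a parametrized surface $x=x(u,v)$ in $\mathbb R^3$, i.e. an immersion of an open subset of $\mathbb R^2$, whose parametric lines are principal ($F=M=0$). Here $E,F,G$ and $L,M,N$ are the coefficients of the first and second fundamental forms, taken with respect to the unit normal $l$ for which $x_u,x_v,l$ is right oriented. Its invariants are the principal normal curvatures and the principal geodesic curvatures $$\nu_1=\frac LE,\qquad \nu_2=\frac NG,\qquad \gamma_1=-\frac{E_v}{2E\sqrt G},\qquad \gamma_2=\frac{G_u}{2G\sqrt E},$$ and it is called strongly regular if $(\nu_1-\nu_2)\gamma_1\gamma_2\neq 0$ everywhere. A motion is an orientation-preserving isometry of $\mathbb R^3$. Let $\mathcal D\subseteq\mathbb R^2$ be open and let $\nu_1,\nu_2,\gamma_1,\gamma_2:\mathcal D\to\mathbb R$ satisfy on $\mathcal D$: 1) $\nu_1-\nu_2>0,\qquad \gamma_1(\nu_1)_v>0,\qquad \gamma_2(\nu_2)_u>0;$ 2.1) $\displaystyle \Big(\ln\frac{(\nu_1)_v}{\gamma_1}\Big)_u=\frac{(\nu_1)_u}{\nu_1-\nu_2},\qquad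 \Big(\ln\frac{(\nu_2)_u}{\gamma_2}\Big)_v=-\frac{(\nu_2)_v}{\nu_1-\nu_2};$ 2.2) $\displaystyle \frac{\nu_1-\nu_2}{2}\left(\frac{(\gamma_1^2)_v}{(\nu_1)_v}-\frac{(\gamma_2^2)_u}{(\nu_2)_u}\right)-(\gamma_1^2+\gamma_2^2)=\nu_1\nu_2.$ Then there exists a strongly regular surface, unique up to a motion, with the prescribed invariants $\nu_1,\nu_2,\gamma_1,\gamma_2$, in the following sense. (a) Every point of $\mathcal D$ has a connected open neighbourhood $\mathcal D_0\subseteq\mathcal D$ over which there is a strongly regular surface $x=x(u,v)$, $(u,v)\in\mathcal D_0$, parametrized by principal lines, with these invariants. (b) If $\mathcal D$ is simply connected, such a surface exists over the whole of $\mathcal D$. (c) If $\mathcal D_0\subseteq\mathcal D$ is open and connected, any two such surfaces over $\mathcal D_0$ with these invariants differ by a motion. -/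

import Mathlib

open scoped ContDiff

namespace Surf

noncomputable section

/-- Euclidean three-space. -/
abbrev E3 : Type := EuclideanSpace ℝ (Fin 3)

/-- The partial derivative `f_u` of a function of `(u, v) ∈ ℝ × ℝ`. -/
def du {V : Type*} [NormedAddCommGroup V] [NormedSpace ℝ V] (f : ℝ × ℝ → V) (p : ℝ × ℝ) : V :=
  fderiv ℝ f p (1, 0)

/-- The partial derivative `f_v` of a function of `(u, v) ∈ ℝ × ℝ`. -/
def dv {V : Type*} [NormedAddCommGroup V] [NormedSpace ℝ V] (f : ℝ × ℝ → V) (p : ℝ × ℝ) : V :=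
  fderiv ℝ f p (0, 1)

/-- The vector product in Euclidean three-space. -/
def cross (a b : E3) : E3 := WithLp.toLp 2 (crossProduct a.ofLp b.ofLp)

/-- The unit normal field `l` of a parametrized surface, oriented so that `(x_u, x_v, l)` is
right oriented. -/
def unitNormal (x : ℝ × ℝ → E3) (p : ℝ × ℝ) : E3 :=
  ‖cross (du x p) (dv x p)‖⁻¹ • cross (du x p) (dv x p)

/-- The coefficient `E` of the first fundamental form. -/
def formE (x : ℝ × ℝ → E3) (p : ℝ × ℝ) : ℝ := inner ℝ (du x p) (du x p)

/-- The coefficient `F` of the first fundamental form. -/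
def formF (x : ℝ × ℝ → E3) (p : ℝ × ℝ) : ℝ := inner ℝ (du x p) (dv x p)

/-- The coefficient `G` of the first fundamental form. -/
def formG (x : ℝ × ℝ → E3) (p : ℝ × ℝ) : ℝ := inner ℝ (dv x p) (dv x p)

/-- The coefficient `L` of the second fundamental form. -/
def formL (x : ℝ × ℝ → E3) (p : ℝ × ℝ) : ℝ := inner ℝ (du (du x) p) (unitNormal x p)

/-- The coefficient `M` of the second fundamental form. -/
def formM (x : ℝ × ℝ → E3) (p : ℝ × ℝ) : ℝ := inner ℝ (dv (du x) p) (unitNormal x p)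

/-- The coefficient `N` of the second fundamental form. -/
def formN (x : ℝ × ℝ → E3) (p : ℝ × ℝ) : ℝ := inner ℝ (dv (dv x) p) (unitNormal x p)

/-- The principal normal curvature `ν₁ = L / E` of the lines `v = const`
(for a principal parametric net). -/
def nu1 (x : ℝ × ℝ → E3) (p : ℝ × ℝ) : ℝ := formL x p / formE x p

/-- The principal normal curvature `ν₂ = N / G` of the lines `u = const`
(for a principal parametric net). -/
def nu2 (x : ℝ × ℝ → E3) (p : ℝ × ℝ) : ℝ := formN x p / formG x p

/-- The principal geodesic curvature `γ₁ = -E_v / (2 E √G)` of the lines `v = const`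
(for a principal parametric net). -/
def gamma1 (x : ℝ × ℝ → E3) (p : ℝ × ℝ) : ℝ :=
  -(dv (formE x) p) / (2 * formE x p * √(formG x p))

/-- The principal geodesic curvature `γ₂ = G_u / (2 G √E)` of the lines `u = const`
(for a principal parametric net). -/
def gamma2 (x : ℝ × ℝ → E3) (p : ℝ × ℝ) : ℝ :=
  du (formG x) p / (2 * formG x p * √(formE x p))

/-- `x`, restricted to the open set `D`, is a strongly regular surface whose parametric lines are
the principal lines: a smooth immersion with `F = M = 0` and `(ν₁ - ν₂) γ₁ γ₂ ≠ 0`. -/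
structure IsStronglyRegularSurface (D : Set (ℝ × ℝ)) (x : ℝ × ℝ → E3) : Prop where
  smooth : ContDiffOn ℝ ∞ x D
  regular : ∀ p ∈ D, LinearIndependent ℝ ![du x p, dv x p]
  principal : ∀ p ∈ D, formF x p = 0 ∧ formM x p = 0
  strong : ∀ p ∈ D, (nu1 x p - nu2 x p) * gamma1 x p * gamma2 x p ≠ 0

/-- The surface `x` over `D` has the invariants `ν₁, ν₂, γ₁, γ₂`. -/
def HasInvariants (D : Set (ℝ × ℝ)) (x : ℝ × ℝ → E3) (ν₁ ν₂ γ₁ γ₂ : ℝ × ℝ → ℝ) : Prop :=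
  ∀ p ∈ D, nu1 x p = ν₁ p ∧ nu2 x p = ν₂ p ∧ gamma1 x p = γ₁ p ∧ gamma2 x p = γ₂ p

/-- A (proper) motion of Euclidean three-space: a rotation followed by a translation. -/
def IsMotion (g : E3 → E3) : Prop :=
  ∃ R ∈ Matrix.specialOrthogonalGroup (Fin 3) ℝ, ∃ b : E3,
    ∀ y : E3, g y = WithLp.toLp 2 (R.mulVec y.ofLp) + b

end

end Surf

/-! Put `P = √E`, `Q = √G`. For a surface along principal lines the Codazzi equations read `(ν₁)_v =
γ₁ Q (ν₁ - ν₂)` and `(ν₂)_u = γ₂ P (ν₁ - ν₂)`. Hence the invariants determine `P` and `Q`, namely as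
`rootE` and `rootG`, and with them all coefficients of the derivation equations of the orthonormal
frame `X = x_u / P`, `Y = x_v / Q`, `l = X × Y`.

Existence: take these quotients as the definition of `P` and `Q`. Condition 2.1 then becomes `Q_u =
γ₂ P Q` and `P_v = -γ₁ P Q`, condition 2.2 becomes the Gauss equation of the frame (`gauss_frame`),
and the two remaining Codazzi equations follow by the product rule. Together they say that the
linear system for `(x, X, Y, l)` is flat. Flat systems are solved locally in
`exists_local_solution_of_flat` and over simply connected sets in `exists_solution_of_flat`. The
frame matrix obeys equations with antisymmetric coefficients, so it stays orthonormal
(`IsFrameOn.orthonormal`), and `isStronglyRegularSurface_of_frame` reads off the invariants.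

Uniqueness: by `exists_frame` every surface with these invariants has a frame solving that same
system. For two frame matrices `R`, `R'` the product `Rᵀ R'` is constant
(`IsFrameOn.transpose_mul_const`), so the frames differ by a fixed rotation and the positions by a
further translation (`exists_motion`). -/

namespace Surf

/-! ### Flat linear systems in two variables on a small square. -/

section LocalFrobenius

open Set Filter Topology

/-- Mean value inequality for `t ↦ f t - t • f' a` on the segment from `a` to `b`, where its
derivative is at most `K * |b - a|`. -/
theorem norm_sub_sub_smul_le_of_hasDerivWithinAt {F : Type*} [NormedAddCommGroup F]
    [NormedSpace ℝ F] {f f' : ℝ → F} {s : Set ℝ} (hs : Convex ℝ s) {K : ℝ}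
    (hf : ∀ t ∈ s, HasDerivWithinAt f (f' t) s t) {a b : ℝ} (ha : a ∈ s) (hb : b ∈ s)
    (hK : ∀ t ∈ s, ‖f' t - f' a‖ ≤ K * |t - a|) :
    ‖f b - f a - (b - a) • f' a‖ ≤ K * |b - a| ^ 2 := by
  have hsub : segment ℝ a b ⊆ s := hs.segment_subset ha hb
  have hK0 : 0 ≤ K * |b - a| := (norm_nonneg _).trans (hK b hb)
  have hder : ∀ t ∈ segment ℝ a b,
      HasDerivWithinAt (fun t => f t - t • f' a) (f' t - f' a) (segment ℝ a b) t := by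
    intro t ht
    have h1 := (hf t (hsub ht)).mono hsub
    have h2 := ((hasDerivAt_id t).smul_const (f' a)).hasDerivWithinAt (s := segment ℝ a b)
    simpa using h1.fun_sub h2
  have key := Convex.norm_image_sub_le_of_norm_hasDerivWithin_le (C := K * |b - a|) hder
    (fun t ht => by
      by_cases hab : b = a
      · subst hab
        simp only [segment_same, mem_singleton_iff] at ht
        subst ht; simp
      have hKn : 0 ≤ K := by
        have : 0 < |b - a| := abs_pos.2 (sub_ne_zero.2 hab)
        exact nonneg_of_mul_nonneg_left hK0 this
      refine (hK t (hsub ht)).trans (mul_le_mul_of_nonneg_left ?_ hKn)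
      rw [segment_eq_uIcc] at ht
      simpa [abs_sub_comm] using abs_sub_left_of_mem_uIcc ht)
    (convex_segment a b) (left_mem_segment ℝ a b) (right_mem_segment ℝ a b)
  have e : f b - f a - (b - a) • f' a = (f b - b • f' a) - (f a - a • f' a) := by module
  rw [e]
  refine key.trans (le_of_eq ?_)
  rw [Real.norm_eq_abs]; ring

/-- A substitute for Gronwall on short intervals: where `‖f‖` is maximal, the mean value inequality
bounds `‖f m‖` by `‖f t₀‖ + (M ‖f m‖ + ε) ρ`, and `M ρ ≤ 1/2` lets the left side absorb the term in
`‖f m‖`. -/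
theorem norm_le_of_hasDerivWithinAt_Icc {F : Type*} [NormedAddCommGroup F]
    [NormedSpace ℝ F] {f f' : ℝ → F} {t₀ ρ M ε : ℝ} (hρ : 0 ≤ ρ) (hM : M * ρ ≤ 1 / 2)
    (hM0 : 0 ≤ M)
    (hf : ∀ t ∈ Icc (t₀ - ρ) (t₀ + ρ), HasDerivWithinAt f (f' t) (Icc (t₀ - ρ) (t₀ + ρ)) t)
    (hb : ∀ t ∈ Icc (t₀ - ρ) (t₀ + ρ), ‖f' t‖ ≤ M * ‖f t‖ + ε) :
    ∀ t ∈ Icc (t₀ - ρ) (t₀ + ρ), ‖f t‖ ≤ 2 * ‖f t₀‖ + 2 * ρ * ε := by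
  have ht₀ : t₀ ∈ Icc (t₀ - ρ) (t₀ + ρ) := ⟨by linarith, by linarith⟩
  have hc : ContinuousOn (fun t => ‖f t‖) (Icc (t₀ - ρ) (t₀ + ρ)) :=
    (fun t ht => (hf t ht).continuousWithinAt.norm)
  obtain ⟨m, hm, hmax⟩ := isCompact_Icc.exists_isMaxOn ⟨t₀, ht₀⟩ hc
  have hmax' : ∀ t ∈ Icc (t₀ - ρ) (t₀ + ρ), ‖f t‖ ≤ ‖f m‖ := fun t ht => hmax ht
  have key := Convex.norm_image_sub_le_of_norm_hasDerivWithin_le (C := M * ‖f m‖ + ε) hf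
    (fun t ht => (hb t ht).trans (by gcongr; exact hmax' t ht)) (convex_Icc _ _) ht₀ hm
  have h1 : ‖m - t₀‖ ≤ ρ := by rw [Real.norm_eq_abs, abs_le]; constructor <;> linarith [hm.1, hm.2]
  have h0 : 0 ≤ M * ‖f m‖ + ε := (norm_nonneg _).trans (hb m hm)
  have h2 : ‖f m‖ ≤ ‖f t₀‖ + (M * ‖f m‖ + ε) * ρ := by
    have := norm_le_norm_add_norm_sub' (f m) (f t₀)
    have h3 := mul_le_mul_of_nonneg_left h1 h0
    linarith
  have h4 : M * ρ * ‖f m‖ ≤ 1 / 2 * ‖f m‖ := by gcongr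
  intro t ht
  have := hmax' t ht
  nlinarith

variable {𝔸 : Type*} [NormedRing 𝔸] [NormedAlgebra ℝ 𝔸]

theorem exists_linear_ode_solution [CompleteSpace 𝔸] {B : ℝ → 𝔸} {t₀ ρ M : ℝ} (hρ : 0 ≤ ρ)
    (hM0 : 0 ≤ M) (hM : M * ρ ≤ 1 / 2) (hB : ContinuousOn B (Icc (t₀ - ρ) (t₀ + ρ)))
    (hBM : ∀ t ∈ Icc (t₀ - ρ) (t₀ + ρ), ‖B t‖ ≤ M) (w₀ : 𝔸) :
    ∃ w : ℝ → 𝔸, w t₀ = w₀ ∧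
      ∀ t ∈ Icc (t₀ - ρ) (t₀ + ρ), HasDerivWithinAt w (B t * w t) (Icc (t₀ - ρ) (t₀ + ρ)) t := by
  have ht₀ : t₀ ∈ Icc (t₀ - ρ) (t₀ + ρ) := ⟨by linarith, by linarith⟩
  -- On the ball of radius `‖w₀‖` about `w₀` the field has norm at most `2 M ‖w₀‖`, so `M ρ ≤ 1/2`
  -- keeps the curve in the ball and the interval need not shrink.
  have hpl : IsPicardLindelof (fun t w => B t * w) (⟨t₀, ht₀⟩ : Icc (t₀ - ρ) (t₀ + ρ)) w₀
      ‖w₀‖₊ 0 (⟨M, hM0⟩ * (2 * ‖w₀‖₊)) ⟨M, hM0⟩ := by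
    refine ⟨fun t ht => ?_, fun x _ => hB.mul continuousOn_const, fun t ht x hx => ?_, ?_⟩
    · refine LipschitzOnWith.of_dist_le_mul fun x _ y _ => ?_
      rw [dist_eq_norm, dist_eq_norm, ← mul_sub]
      exact (norm_mul_le _ _).trans (mul_le_mul_of_nonneg_right (hBM t ht) (norm_nonneg _))
    · have hx' : ‖x‖ ≤ 2 * ‖w₀‖ := by
        rw [Metric.mem_closedBall, dist_eq_norm] at hx
        have := norm_le_norm_add_norm_sub' x w₀
        simp only [coe_nnnorm] at hx
        linarith
      exact (norm_mul_le _ _).trans (mul_le_mul (hBM t ht) hx' (norm_nonneg _) hM0)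
    · change M * (2 * ‖w₀‖) * max (t₀ + ρ - t₀) (t₀ - (t₀ - ρ)) ≤ ‖w₀‖ - 0
      rw [add_sub_cancel_left, sub_sub_cancel, max_self, sub_zero]
      nlinarith [norm_nonneg w₀]
  exact hpl.exists_eq_forall_mem_Icc_hasDerivWithinAt₀

/-- The differential `du ⊗ a + dv ⊗ b`. -/
noncomputable def pairCLM {V : Type*} [NormedAddCommGroup V] [NormedSpace ℝ V] (a b : V) :
    ℝ × ℝ →L[ℝ] V :=
  (ContinuousLinearMap.toSpanSingleton ℝ a).coprod (ContinuousLinearMap.toSpanSingleton ℝ b)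

@[simp]
theorem pairCLM_apply {V : Type*} [NormedAddCommGroup V] [NormedSpace ℝ V] (a b : V)
    (p : ℝ × ℝ) : pairCLM a b p = p.1 • a + p.2 • b := by
  simp [pairCLM]

/-- The data of a flat linear system `W_u = A W`, `W_v = B W` on a small closed square, with
the quantitative bounds used to solve it. -/
structure IsFlatOnSquare (A B A' B' : ℝ → ℝ → 𝔸) (u₀ v₀ ρ M K : ℝ) : Prop where
  rho_pos : 0 < ρ
  M_nonneg : 0 ≤ M
  K_nonneg : 0 ≤ K
  M_mul : M * ρ ≤ 1 / 2
  norm_A : ∀ u ∈ Icc (u₀ - ρ) (u₀ + ρ), ∀ v ∈ Icc (v₀ - ρ) (v₀ + ρ), ‖A u v‖ ≤ M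
  norm_B : ∀ u ∈ Icc (u₀ - ρ) (u₀ + ρ), ∀ v ∈ Icc (v₀ - ρ) (v₀ + ρ), ‖B u v‖ ≤ M
  deriv_A : ∀ u ∈ Icc (u₀ - ρ) (u₀ + ρ), ∀ v ∈ Icc (v₀ - ρ) (v₀ + ρ),
    HasDerivAt (fun t => A u t) (A' u v) v
  deriv_B : ∀ u ∈ Icc (u₀ - ρ) (u₀ + ρ), ∀ v ∈ Icc (v₀ - ρ) (v₀ + ρ),
    HasDerivAt (fun t => B t v) (B' u v) u
  cont_A : ContinuousOn (fun p : ℝ × ℝ => A p.1 p.2)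
    (Icc (u₀ - ρ) (u₀ + ρ) ×ˢ Icc (v₀ - ρ) (v₀ + ρ))
  cont_B : ContinuousOn (fun p : ℝ × ℝ => B p.1 p.2)
    (Icc (u₀ - ρ) (u₀ + ρ) ×ˢ Icc (v₀ - ρ) (v₀ + ρ))
  lip_A : ∀ u ∈ Icc (u₀ - ρ) (u₀ + ρ), ∀ u' ∈ Icc (u₀ - ρ) (u₀ + ρ),
    ∀ v ∈ Icc (v₀ - ρ) (v₀ + ρ), ‖A u' v - A u v‖ ≤ K * |u' - u|
  lip_B : ∀ u ∈ Icc (u₀ - ρ) (u₀ + ρ), ∀ u' ∈ Icc (u₀ - ρ) (u₀ + ρ),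
    ∀ v ∈ Icc (v₀ - ρ) (v₀ + ρ), ‖B u' v - B u v‖ ≤ K * |u' - u|
  lip_B' : ∀ u ∈ Icc (u₀ - ρ) (u₀ + ρ), ∀ u' ∈ Icc (u₀ - ρ) (u₀ + ρ),
    ∀ v ∈ Icc (v₀ - ρ) (v₀ + ρ), ‖B' u' v - B' u v‖ ≤ K * |u' - u|
  flat : ∀ u ∈ Icc (u₀ - ρ) (u₀ + ρ), ∀ v ∈ Icc (v₀ - ρ) (v₀ + ρ),
    A' u v + A u v * B u v = B' u v + B u v * A u v

/-- Solve `Y_u = A Y` along `v = v₀`, then `V_v = B V` on each vertical segment starting from `Y u`.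
That `V_u = A V` also holds off the initial line is where flatness is needed. It follows from a
remainder estimate quadratic in `u' - u`, so smooth dependence of solutions on parameters is not
invoked. -/
theorem IsFlatOnSquare.exists_solution [CompleteSpace 𝔸] {A B A' B' : ℝ → ℝ → 𝔸}
    {u₀ v₀ ρ M K : ℝ} (h : IsFlatOnSquare A B A' B' u₀ v₀ ρ M K) :
    ∃ W : ℝ × ℝ → 𝔸, W (u₀, v₀) = 1 ∧ ∀ p ∈ Ioo (u₀ - ρ) (u₀ + ρ) ×ˢ Ioo (v₀ - ρ) (v₀ + ρ),
      HasFDerivAt W (pairCLM (A p.1 p.2 * W p) (B p.1 p.2 * W p)) p := by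
  set I := Icc (u₀ - ρ) (u₀ + ρ) with hI
  set J := Icc (v₀ - ρ) (v₀ + ρ) with hJ
  have hρ := h.rho_pos
  have hM0 := h.M_nonneg
  have hK0 := h.K_nonneg
  have hu₀ : u₀ ∈ I := ⟨by linarith, by linarith⟩
  have hv₀ : v₀ ∈ J := ⟨by linarith, by linarith⟩
  obtain ⟨Y, hY0, hY⟩ := exists_linear_ode_solution (B := fun u => A u v₀) hρ.le hM0 h.M_mul
    (h.cont_A.comp (by fun_prop : Continuous fun u : ℝ => (u, v₀)).continuousOn
      (fun u hu => ⟨hu, hv₀⟩)) (fun u hu => h.norm_A u hu v₀ hv₀) 1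
  have hV : ∀ u : ℝ, ∃ w : ℝ → 𝔸, u ∈ I → w v₀ = Y u ∧
      ∀ t ∈ J, HasDerivWithinAt w (B u t * w t) J t := by
    intro u
    by_cases hu : u ∈ I
    · obtain ⟨w, hw⟩ := exists_linear_ode_solution (B := fun v => B u v) (t₀ := v₀) hρ.le hM0
        h.M_mul (h.cont_B.comp (by fun_prop : Continuous fun v : ℝ => (u, v)).continuousOn
        (fun v hv => ⟨hu, hv⟩)) (fun v hv => h.norm_B u hu v hv) (Y u)
      exact ⟨w, fun _ => hw⟩
    · exact ⟨0, fun h => absurd h hu⟩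
  choose V hV using hV
  obtain ⟨C₀, hC₀⟩ : ∃ C₀ : ℝ, C₀ = 2 * ‖(1 : 𝔸)‖ := ⟨_, rfl⟩
  have hC₀n : 0 ≤ C₀ := by rw [hC₀]; positivity
  have hYb : ∀ u ∈ I, ‖Y u‖ ≤ C₀ := by
    intro u hu
    have := norm_le_of_hasDerivWithinAt_Icc (ε := 0) hρ.le h.M_mul hM0 hY (fun t ht => by
      rw [add_zero]
      exact (norm_mul_le _ _).trans (mul_le_mul_of_nonneg_right (h.norm_A t ht v₀ hv₀)
        (norm_nonneg _))) u hu
    rw [hY0] at this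
    rw [hC₀]; linarith
  have hVb : ∀ u ∈ I, ∀ v ∈ J, ‖V u v‖ ≤ 2 * C₀ := by
    intro u hu v hv
    have := norm_le_of_hasDerivWithinAt_Icc (ε := 0) hρ.le h.M_mul hM0 (hV u hu).2 (fun t ht => by
      rw [add_zero]
      exact (norm_mul_le _ _).trans (mul_le_mul_of_nonneg_right (h.norm_B u hu t ht)
        (norm_nonneg _))) v hv
    rw [(hV u hu).1] at this
    have := hYb u hu
    linarith
  have hYlip : ∀ u ∈ I, ∀ u' ∈ I, ‖Y u' - Y u‖ ≤ M * C₀ * |u' - u| := by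
    intro u hu u' hu'
    exact Convex.norm_image_sub_le_of_norm_hasDerivWithin_le hY (fun t ht =>
      (norm_mul_le _ _).trans (mul_le_mul (h.norm_A t ht v₀ hv₀) (hYb t ht) (norm_nonneg _) hM0))
      (convex_Icc _ _) hu hu'
  have hYq : ∀ u ∈ I, ∀ u' ∈ I,
      ‖Y u' - Y u - (u' - u) • (A u v₀ * Y u)‖ ≤ (K * C₀ + M * (M * C₀)) * |u' - u| ^ 2 := by
    intro u hu u' hu'
    refine norm_sub_sub_smul_le_of_hasDerivWithinAt (f' := fun u => A u v₀ * Y u)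
      (convex_Icc _ _) hY hu hu' (fun t ht => ?_)
    have e : A t v₀ * Y t - A u v₀ * Y u = (A t v₀ - A u v₀) * Y t + A u v₀ * (Y t - Y u) := by
      noncomm_ring
    rw [e]
    refine (norm_add_le _ _).trans ?_
    have h1 := (norm_mul_le (A t v₀ - A u v₀) (Y t)).trans
      (mul_le_mul (h.lip_A u hu t ht v₀ hv₀) (hYb t ht) (norm_nonneg _) (by positivity))
    have h2 := (norm_mul_le (A u v₀) (Y t - Y u)).trans
      (mul_le_mul (h.norm_A u hu v₀ hv₀) (hYlip u hu t ht) (norm_nonneg _) hM0)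
    linarith
  -- The Lipschitz constant of `V` in `u`: the difference of two vertical solutions solves the
  -- `B`-equation up to an error `K (2 C₀) |u' - u|`.
  obtain ⟨C₁, hC₁⟩ : ∃ C₁ : ℝ, C₁ = 2 * (M * C₀) + 2 * ρ * (K * (2 * C₀)) := ⟨_, rfl⟩
  have hC₁n : 0 ≤ C₁ := by rw [hC₁]; positivity
  have hVlip : ∀ u ∈ I, ∀ u' ∈ I, ∀ v ∈ J, ‖V u' v - V u v‖ ≤ C₁ * |u' - u| := by
    intro u hu u' hu' v hv
    have := norm_le_of_hasDerivWithinAt_Icc (f := fun t => V u' t - V u t)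
      (f' := fun t => B u' t * V u' t - B u t * V u t) (ε := K * (2 * C₀) * |u' - u|)
      hρ.le h.M_mul hM0
      (fun t ht => ((hV u' hu').2 t ht).sub ((hV u hu).2 t ht)) (fun t ht => by
        have e : B u' t * V u' t - B u t * V u t
          = B u' t * (V u' t - V u t) + (B u' t - B u t) * V u t := by noncomm_ring
        rw [e]
        refine (norm_add_le _ _).trans ?_
        have h1 := (norm_mul_le (B u' t) (V u' t - V u t)).trans
          (mul_le_mul_of_nonneg_right (h.norm_B u' hu' t ht) (norm_nonneg _))
        have h2 := (norm_mul_le (B u' t - B u t) (V u t)).trans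
          (mul_le_mul (h.lip_B u hu u' hu' t ht) (hVb u hu t ht) (norm_nonneg _) (by positivity))
        linarith) v hv
    simp only [(hV u hu).1, (hV u' hu').1] at this
    have h3 := hYlip u hu u' hu'
    rw [hC₁]
    linarith
  obtain ⟨C₂, hC₂⟩ : ∃ C₂ : ℝ, C₂ = 2 * (K * C₀ + M * (M * C₀))
    + 2 * ρ * (K * (2 * C₀) + K * C₁) := ⟨_, rfl⟩
  -- As a function of `t = v`, the first order remainder in `u` solves the `B`-equation up to an
  -- error of order `|u' - u| ^ 2`, and its value at `v₀` is controlled by `hYq`.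
  have hVq : ∀ u ∈ I, ∀ u' ∈ I, ∀ v ∈ J,
      ‖V u' v - V u v - (u' - u) • (A u v * V u v)‖ ≤ C₂ * |u' - u| ^ 2 := by
    intro u hu u' hu' v hv
    have := norm_le_of_hasDerivWithinAt_Icc
      (f := fun t => V u' t - V u t - (u' - u) • (A u t * V u t))
      (f' := fun t => B u' t * V u' t - B u t * V u t
        - (u' - u) • (A' u t * V u t + A u t * (B u t * V u t)))
      (ε := (K * (2 * C₀) + K * C₁) * |u' - u| ^ 2) hρ.le h.M_mul hM0
      (fun t ht => (((hV u' hu').2 t ht).sub ((hV u hu).2 t ht)).sub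
        (((h.deriv_A u hu t ht).hasDerivWithinAt.fun_mul ((hV u hu).2 t ht)).fun_const_smul _))
      (fun t ht => by
        -- Flatness cancels the terms linear in `u' - u`; what is left is `B` times the remainder
        -- plus two quadratic errors.
        have hA' : A' u t = B' u t + B u t * A u t - A u t * B u t := by
          rw [← h.flat u hu t ht]; abel
        have e : B u' t * V u' t - B u t * V u t
            - (u' - u) • (A' u t * V u t + A u t * (B u t * V u t))
          = B u t * (V u' t - V u t - (u' - u) • (A u t * V u t))
            + (B u' t - B u t - (u' - u) • B' u t) * V u t
            + (B u' t - B u t) * (V u' t - V u t) := by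
          rw [hA']
          simp only [mul_sub, sub_mul, add_mul, smul_mul_assoc, mul_smul_comm, mul_assoc]
          module
        rw [e]
        refine (norm_add₃_le).trans ?_
        have h1 := (norm_mul_le (B u t) (V u' t - V u t - (u' - u) • (A u t * V u t))).trans
          (mul_le_mul_of_nonneg_right (h.norm_B u hu t ht) (norm_nonneg _))
        have hBq : ‖B u' t - B u t - (u' - u) • B' u t‖ ≤ K * |u' - u| ^ 2 :=
          norm_sub_sub_smul_le_of_hasDerivWithinAt (f := fun s => B s t) (f' := fun s => B' s t)
            (convex_Icc _ _) (fun s hs => (h.deriv_B s hs t ht).hasDerivWithinAt) hu hu'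
            (fun s hs => h.lip_B' u hu s hs t ht)
        have h2 := (norm_mul_le (B u' t - B u t - (u' - u) • B' u t) (V u t)).trans
          (mul_le_mul hBq (hVb u hu t ht) (norm_nonneg _) (by positivity))
        have h3 := (norm_mul_le (B u' t - B u t) (V u' t - V u t)).trans
          (mul_le_mul (h.lip_B u hu u' hu' t ht) (hVlip u hu u' hu' t ht) (norm_nonneg _)
            (by positivity))
        linarith) v hv
    simp only [(hV u hu).1, (hV u' hu').1] at this
    have h3 := hYq u hu u' hu'
    rw [hC₂]
    linarith
  have hcont : ContinuousOn (fun p : ℝ × ℝ => V p.1 p.2) (I ×ˢ J) := by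
    rintro ⟨u, v⟩ ⟨hu, hv⟩
    have h1 : ContinuousWithinAt (fun p : ℝ × ℝ => V u p.2) (I ×ˢ J) (u, v) :=
      ContinuousWithinAt.comp (t := J) ((hV u hu).2 v hv).continuousWithinAt
        continuous_snd.continuousWithinAt (fun p hp => hp.2)
    have h2 : Tendsto (fun p : ℝ × ℝ => V p.1 p.2 - V u p.2) (𝓝[I ×ˢ J] (u, v)) (𝓝 0) := by
      refine squeeze_zero_norm' (a := fun p : ℝ × ℝ => C₁ * |p.1 - u|) ?_ ?_
      · filter_upwards [self_mem_nhdsWithin] with p hp using hVlip u hu p.1 hp.1 p.2 hp.2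
      · have : Continuous (fun p : ℝ × ℝ => C₁ * |p.1 - u|) := by fun_prop
        simpa using (this.tendsto (u, v)).mono_left nhdsWithin_le_nhds
    have h3 := h2.add h1
    simpa [ContinuousWithinAt] using h3
  refine ⟨fun p => V p.1 p.2, by simp [(hV u₀ hu₀).1, hY0], ?_⟩
  rintro ⟨u, v⟩ ⟨hu, hv⟩
  have hnhds : ∀ᶠ p : ℝ × ℝ in 𝓝 (u, v),
      p ∈ Ioo (u₀ - ρ) (u₀ + ρ) ×ˢ Ioo (v₀ - ρ) (v₀ + ρ) :=
    (isOpen_Ioo.prod isOpen_Ioo).mem_nhds ⟨hu, hv⟩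
  have hIJ : I ×ˢ J ∈ 𝓝 (u, v) := by
    filter_upwards [hnhds] with p hp using ⟨Ioo_subset_Icc_self hp.1, Ioo_subset_Icc_self hp.2⟩
  have hcV := hcont.continuousAt hIJ
  have hcA := h.cont_A.continuousAt hIJ
  have hcB := h.cont_B.continuousAt hIJ
  have hsp : Continuous (fun a : 𝔸 => ContinuousLinearMap.toSpanSingleton ℝ a) :=
    (ContinuousLinearMap.toSpanSingletonLIE ℝ 𝔸).continuous
  -- Continuous partial derivatives give the total derivative; the one in `u` comes from the
  -- quadratic bound `hVq`.
  have := hasStrictFDerivAt_uncurry_coprod (𝕜 := ℝ) (u := (u, v)) (f := V)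
    (f₁ := fun a b => ContinuousLinearMap.toSpanSingleton ℝ (A a b * V a b))
    (f₂ := fun a b => ContinuousLinearMap.toSpanSingleton ℝ (B a b * V a b))
    (by
      filter_upwards [hnhds] with p hp
      have hp1 := Ioo_subset_Icc_self hp.1
      have hp2 := Ioo_subset_Icc_self hp.2
      have h0 : HasFDerivAt (fun s => V s p.2 - V p.1 p.2 - (s - p.1) • (A p.1 p.2 * V p.1 p.2))
          (0 : ℝ →L[ℝ] 𝔸) p.1 := by
        refine Asymptotics.IsBigO.hasFDerivAt (n := 2) ?_ (by norm_num)
        refine Asymptotics.IsBigO.of_bound C₂ ?_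
        filter_upwards [Icc_mem_nhds hp.1.1 hp.1.2] with s hs
        simpa using hVq p.1 hp1 s hs p.2 hp2
      have h1 : HasFDerivAt (fun s : ℝ => V p.1 p.2 + (s - p.1) • (A p.1 p.2 * V p.1 p.2))
          (ContinuousLinearMap.toSpanSingleton ℝ (A p.1 p.2 * V p.1 p.2)) p.1 := by
        have := (((hasDerivAt_id p.1).sub_const p.1).smul_const
          (A p.1 p.2 * V p.1 p.2)).const_add (V p.1 p.2)
        simpa using! this.hasFDerivAt
      have h2 := h0.add h1
      rw [zero_add] at h2
      refine h2.congr_of_eventuallyEq (Eventually.of_forall fun s => ?_)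
      simp only [Pi.add_apply]
      abel)
    (by
      filter_upwards [hnhds] with p hp
      exact (((hV p.1 (Ioo_subset_Icc_self hp.1)).2 p.2 (Ioo_subset_Icc_self hp.2)).hasDerivAt
        (Icc_mem_nhds hp.2.1 hp.2.2)).hasFDerivAt)
    (hsp.continuousAt.comp (hcA.mul hcV)) (hsp.continuousAt.comp (hcB.mul hcV))
  exact this.hasFDerivAt

end LocalFrobenius

/-! ### Calculus of the partial derivatives `du` and `dv`. -/

section Partial

open Set Filter Topology

variable {V : Type*} [NormedAddCommGroup V] [NormedSpace ℝ V]

theorem contDiffOn_du {f : ℝ × ℝ → V} {D : Set (ℝ × ℝ)} (hD : IsOpen D)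
    (hf : ContDiffOn ℝ ∞ f D) : ContDiffOn ℝ ∞ (du f) D :=
  (hf.fderiv_of_isOpen hD (m := ∞) (by simp)).clm_apply contDiffOn_const

theorem contDiffOn_dv {f : ℝ × ℝ → V} {D : Set (ℝ × ℝ)} (hD : IsOpen D)
    (hf : ContDiffOn ℝ ∞ f D) : ContDiffOn ℝ ∞ (dv f) D :=
  (hf.fderiv_of_isOpen hD (m := ∞) (by simp)).clm_apply contDiffOn_const

theorem differentiableAt_of_contDiffOn {f : ℝ × ℝ → V} {D : Set (ℝ × ℝ)} (hD : IsOpen D)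
    (hf : ContDiffOn ℝ ∞ f D) {p : ℝ × ℝ} (hp : p ∈ D) : DifferentiableAt ℝ f p :=
  (hf.contDiffAt (hD.mem_nhds hp)).differentiableAt (by simp)

theorem fderiv_eq_pairCLM (f : ℝ × ℝ → V) (p : ℝ × ℝ) :
    fderiv ℝ f p = pairCLM (du f p) (dv f p) := by
  ext <;> simp [du, dv]

theorem hasFDerivAt_pairCLM {f : ℝ × ℝ → V} {p : ℝ × ℝ} (hf : DifferentiableAt ℝ f p) :
    HasFDerivAt f (pairCLM (du f p) (dv f p)) p :=
  fderiv_eq_pairCLM f p ▸ hf.hasFDerivAt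

theorem du_eq_of_hasFDerivAt {f : ℝ × ℝ → V} {p : ℝ × ℝ} {a b : V}
    (hf : HasFDerivAt f (pairCLM a b) p) : du f p = a := by
  simp [du, hf.fderiv]

theorem dv_eq_of_hasFDerivAt {f : ℝ × ℝ → V} {p : ℝ × ℝ} {a b : V}
    (hf : HasFDerivAt f (pairCLM a b) p) : dv f p = b := by
  simp [dv, hf.fderiv]

theorem du_congr {f g : ℝ × ℝ → V} {D : Set (ℝ × ℝ)} (hD : IsOpen D)
    (h : ∀ p ∈ D, f p = g p) {p : ℝ × ℝ} (hp : p ∈ D) : du f p = du g p := by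
  have : f =ᶠ[𝓝 p] g := by filter_upwards [hD.mem_nhds hp] with q hq using h q hq
  simp [du, this.fderiv_eq]

theorem dv_congr {f g : ℝ × ℝ → V} {D : Set (ℝ × ℝ)} (hD : IsOpen D)
    (h : ∀ p ∈ D, f p = g p) {p : ℝ × ℝ} (hp : p ∈ D) : dv f p = dv g p := by
  have : f =ᶠ[𝓝 p] g := by filter_upwards [hD.mem_nhds hp] with q hq using h q hq
  simp [dv, this.fderiv_eq]

theorem dv_du_eq_du_dv {f : ℝ × ℝ → V} {D : Set (ℝ × ℝ)} (hD : IsOpen D)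
    (hf : ContDiffOn ℝ ∞ f D) {p : ℝ × ℝ} (hp : p ∈ D) : dv (du f) p = du (dv f) p := by
  have hs : IsSymmSndFDerivAt ℝ f p :=
    (hf.contDiffAt (hD.mem_nhds hp)).isSymmSndFDerivAt
      (by simpa using (by norm_cast : (2 : WithTop ℕ∞) ≤ ∞))
  have hd : DifferentiableAt ℝ (fderiv ℝ f) p :=
    ((hf.fderiv_of_isOpen hD (m := ∞) (by simp)).contDiffAt
      (hD.mem_nhds hp)).differentiableAt (by simp)
  have h1 : ∀ w z : ℝ × ℝ, fderiv ℝ (fun q => fderiv ℝ f q w) p z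
      = fderiv ℝ (fderiv ℝ f) p z w := by
    intro w z
    rw [fderiv_clm_apply hd (differentiableAt_const _)]
    simp
  change fderiv ℝ (fun q => fderiv ℝ f q (1, 0)) p (0, 1)
    = fderiv ℝ (fun q => fderiv ℝ f q (0, 1)) p (1, 0)
  rw [h1, h1]
  exact hs.eq _ _

end Partial

/-! ### Flat systems on open sets: local solutions, gluing, smoothness. -/

section Frobenius

open Set Filter Topology

variable {𝔸 : Type*} [NormedRing 𝔸] [NormedAlgebra ℝ 𝔸]

theorem exists_local_solution_of_flat [CompleteSpace 𝔸] {D : Set (ℝ × ℝ)} (hD : IsOpen D)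
    {A B : ℝ × ℝ → 𝔸} (hA : ContDiffOn ℝ ∞ A D) (hB : ContDiffOn ℝ ∞ B D)
    (hflat : ∀ p ∈ D, dv A p + A p * B p = du B p + B p * A p) {p₀ : ℝ × ℝ} (hp₀ : p₀ ∈ D) :
    ∃ ρ > 0, Metric.ball p₀ ρ ⊆ D ∧ ∃ W : ℝ × ℝ → 𝔸, W p₀ = 1 ∧
      ∀ p ∈ Metric.ball p₀ ρ, HasFDerivAt W (pairCLM (A p * W p) (B p * W p)) p := by
  have hn := hD.mem_nhds hp₀
  have lip : ∀ f : ℝ × ℝ → 𝔸, ContDiffOn ℝ ∞ f D → ∃ K : NNReal, ∃ t ∈ 𝓝 p₀,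
      LipschitzOnWith K f t := fun f hf =>
    ((hf.contDiffAt hn).of_le (by norm_cast)).exists_lipschitzOnWith
  obtain ⟨K₁, t₁, ht₁, hl₁⟩ := lip A hA
  obtain ⟨K₂, t₂, ht₂, hl₂⟩ := lip B hB
  obtain ⟨K₃, t₃, ht₃, hl₃⟩ := lip (du B) (contDiffOn_du hD hB)
  have bd : ∀ f : ℝ × ℝ → 𝔸, ContDiffOn ℝ ∞ f D → ∀ᶠ p in 𝓝 p₀, ‖f p‖ < ‖f p₀‖ + 1 :=
    fun f hf => (hf.contDiffAt hn).continuousAt.norm.eventually_lt_const (by linarith)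
  have hev : ∀ᶠ p in 𝓝 p₀, p ∈ D ∧ p ∈ t₁ ∧ p ∈ t₂ ∧ p ∈ t₃ ∧ ‖A p‖ < ‖A p₀‖ + 1 ∧
      ‖B p‖ < ‖B p₀‖ + 1 := by
    filter_upwards [hn, ht₁, ht₂, ht₃, bd A hA, bd B hB] with p h1 h2 h3 h4 h5 h6
    exact ⟨h1, h2, h3, h4, h5, h6⟩
  obtain ⟨r, hr, hball⟩ := Metric.nhds_basis_closedBall.eventually_iff.1 hev
  set M : ℝ := ‖A p₀‖ + ‖B p₀‖ + 1 with hM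
  have hMpos : 0 < M := by positivity
  -- The second entry secures `M * ρ ≤ 1 / 2`.
  set ρ : ℝ := min r (1 / (2 * M)) with hρdef
  have hρ : 0 < ρ := lt_min hr (by positivity)
  have hmem : ∀ u ∈ Icc (p₀.1 - ρ) (p₀.1 + ρ), ∀ v ∈ Icc (p₀.2 - ρ) (p₀.2 + ρ),
      (u, v) ∈ D ∧ (u, v) ∈ t₁ ∧ (u, v) ∈ t₂ ∧ (u, v) ∈ t₃ ∧ ‖A (u, v)‖ < ‖A p₀‖ + 1 ∧
      ‖B (u, v)‖ < ‖B p₀‖ + 1 := by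
    intro u hu v hv
    refine hball (Metric.closedBall_subset_closedBall (min_le_left r (1 / (2 * M))) ?_)
    rw [← Real.closedBall_eq_Icc] at hu hv
    rw [← hρdef]
    exact (closedBall_prod_same p₀.1 p₀.2 ρ).subset ⟨hu, hv⟩
  set K : ℝ := K₁ + K₂ + K₃ with hK
  have hK1 : (K₁ : ℝ) ≤ K := by rw [hK]; have := K₂.2; have := K₃.2; simp; linarith
  have hK2 : (K₂ : ℝ) ≤ K := by rw [hK]; have := K₁.2; have := K₃.2; simp; linarith
  have hK3 : (K₃ : ℝ) ≤ K := by rw [hK]; have := K₁.2; have := K₂.2; simp; linarith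
  have lipu : ∀ (f : ℝ × ℝ → 𝔸) (L : NNReal) (t : Set (ℝ × ℝ)), LipschitzOnWith L f t →
      (L : ℝ) ≤ K → ∀ u u' v : ℝ, (u, v) ∈ t → (u', v) ∈ t →
      ‖f (u', v) - f (u, v)‖ ≤ K * |u' - u| := by
    intro f L t hL hLK u u' v hu hu'
    have := hL.dist_le_mul _ hu' _ hu
    rw [dist_eq_norm, Prod.dist_eq, dist_self, Real.dist_eq, max_eq_left (abs_nonneg _)] at this
    exact this.trans (mul_le_mul_of_nonneg_right hLK (abs_nonneg _))
  have hsq : IsFlatOnSquare (fun u v => A (u, v)) (fun u v => B (u, v))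
      (fun u v => dv A (u, v)) (fun u v => du B (u, v)) p₀.1 p₀.2 ρ M K := by
    refine ⟨hρ, hMpos.le, by positivity, ?_, ?_, ?_, ?_, ?_, ?_, ?_, ?_, ?_, ?_, ?_⟩
    · have : ρ ≤ 1 / (2 * M) := min_le_right _ _
      calc M * ρ ≤ M * (1 / (2 * M)) := by gcongr
        _ = 1 / 2 := by field_simp
    · intro u hu v hv
      have := (hmem u hu v hv).2.2.2.2.1
      linarith [norm_nonneg (B p₀)]
    · intro u hu v hv
      have := (hmem u hu v hv).2.2.2.2.2
      linarith [norm_nonneg (A p₀)]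
    · intro u hu v hv
      have h1 := (differentiableAt_of_contDiffOn hD hA (hmem u hu v hv).1).hasFDerivAt
      exact h1.comp_hasDerivAt v ((hasDerivAt_const v u).prodMk (hasDerivAt_id v))
    · intro u hu v hv
      have h1 := (differentiableAt_of_contDiffOn hD hB (hmem u hu v hv).1).hasFDerivAt
      exact h1.comp_hasDerivAt u ((hasDerivAt_id u).prodMk (hasDerivAt_const u v))
    · exact hA.continuousOn.mono fun p hp => (hmem p.1 hp.1 p.2 hp.2).1
    · exact hB.continuousOn.mono fun p hp => (hmem p.1 hp.1 p.2 hp.2).1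
    · intro u hu u' hu' v hv
      exact lipu A K₁ t₁ hl₁ hK1 u u' v (hmem u hu v hv).2.1 (hmem u' hu' v hv).2.1
    · intro u hu u' hu' v hv
      exact lipu B K₂ t₂ hl₂ hK2 u u' v (hmem u hu v hv).2.2.1 (hmem u' hu' v hv).2.2.1
    · intro u hu u' hu' v hv
      exact lipu (du B) K₃ t₃ hl₃ hK3 u u' v (hmem u hu v hv).2.2.2.1 (hmem u' hu' v hv).2.2.2.1
    · intro u hu v hv
      exact hflat _ (hmem u hu v hv).1
  obtain ⟨W, hW0, hW⟩ := hsq.exists_solution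
  have hballeq : Metric.ball p₀ ρ
      = Ioo (p₀.1 - ρ) (p₀.1 + ρ) ×ˢ Ioo (p₀.2 - ρ) (p₀.2 + ρ) := by
    rw [← Real.ball_eq_Ioo, ← Real.ball_eq_Ioo, ball_prod_same]
  refine ⟨ρ, hρ, fun p hp => ?_, W, hW0, fun p hp => hW p (hballeq ▸ hp)⟩
  rw [hballeq] at hp
  exact (hmem p.1 (Ioo_subset_Icc_self hp.1) p.2 (Ioo_subset_Icc_self hp.2)).1

/-- Local sections of a locally constant system of group valued functions over a simply connected
space glue to a global one. -/
theorem exists_global_of_locally_const {X ι Γ : Type*} [TopologicalSpace X]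
    [SimplyConnectedSpace X] [LocallyPathConnectedSpace X] [Group Γ] (U : ι → Set X)
    (hU : ∀ i, IsOpen (U i)) (ix : X → ι) (hix : ∀ x, x ∈ U (ix x)) (f : ι → X → Γ)
    (hf : ∀ i j, ∀ x ∈ U i ∩ U j, ∀ᶠ y in 𝓝 x, (f j y)⁻¹ * f i y = (f j x)⁻¹ * f i x) :
    ∃ F : X → Γ, ∀ i, ∀ x ∈ U i, ∀ᶠ y in 𝓝 x, (f i y)⁻¹ * F y = (f i x)⁻¹ * F x := by
  -- With the discrete topology on `Γ` the locally constant transition functions define a bundle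
  -- that is a covering of `X`. Simple connectedness lifts the identity to a global section, and the
  -- section read back through the `f i` is `F`.
  let _ : TopologicalSpace Γ := ⊥
  have : DiscreteTopology Γ := ⟨rfl⟩
  let Z : FiberBundleCore ι X Γ :=
    { baseSet := U
      isOpen_baseSet := hU
      indexAt := ix
      mem_baseSet_at := hix
      coordChange := fun i j x c => (f j x)⁻¹ * f i x * c
      coordChange_self := by intro i x _ v; simp
      continuousOn_coordChange := by
        rintro i j ⟨x, c⟩ ⟨hx, -⟩
        refine ContinuousAt.continuousWithinAt ?_
        refine (continuousAt_const (y := (f j x)⁻¹ * f i x * c)).congr ?_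
        have h1 : ∀ᶠ p : X × Γ in 𝓝 (x, c), (f j p.1)⁻¹ * f i p.1 = (f j x)⁻¹ * f i x :=
          (continuous_fst.tendsto (x, c)).eventually (hf i j x hx)
        have h2 : ∀ᶠ p : X × Γ in 𝓝 (x, c), p.2 = c :=
          (continuous_snd.tendsto (x, c)).eventually
            ((isOpen_discrete {c}).mem_nhds rfl)
        filter_upwards [h1, h2] with p hp1 hp2
        rw [hp1, hp2]
      coordChange_comp := by intro i j k x _ v; group }
  have hcov : IsCoveringMap (Bundle.TotalSpace.proj : Z.TotalSpace → X) :=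
    FiberBundle.isCoveringMap
  obtain ⟨x₀⟩ : Nonempty X := inferInstance
  obtain ⟨s, ⟨-, hs⟩, -⟩ := hcov.existsUnique_continuousMap_lifts (ContinuousMap.id X) x₀
    (⟨x₀, (1 : Γ)⟩ : Z.TotalSpace) rfl
  have hs' : ∀ x, (s x).proj = x := fun x => congrFun hs x
  refine ⟨fun x => f (ix (s x).proj) (s x).proj * (show Γ from (s x).2), fun i x hx => ?_⟩
  have hcont : ContinuousAt (fun y => (Z.localTriv i (s y)).2) x := by
    refine ContinuousAt.snd (ContinuousAt.comp (f := s) (g := Z.localTriv i) ?_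
      s.continuous.continuousAt)
    refine (Z.localTriv i).continuousAt ?_
    rw [Bundle.Trivialization.mem_source]
    change (s x).proj ∈ U i
    rwa [hs']
  have hev : ∀ᶠ y in 𝓝 x, (Z.localTriv i (s y)).2 = (Z.localTriv i (s x)).2 :=
    hcont.eventually ((isOpen_discrete {(Z.localTriv i (s x)).2}).mem_nhds rfl)
  filter_upwards [hev] with y hy
  have key : ∀ z, (Z.localTriv i (s z)).2
      = (f i (s z).proj)⁻¹ * f (ix (s z).proj) (s z).proj * (show Γ from (s z).2) := fun z => rfl
  rw [key, key] at hy
  simp only [hs'] at hy ⊢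
  exact (mul_assoc _ _ _).symm.trans (hy.trans (mul_assoc _ _ _))

theorem hasFDerivAt_mul_const_of_system {A B W : ℝ × ℝ → 𝔸} {p : ℝ × ℝ}
    (hW : HasFDerivAt W (pairCLM (A p * W p) (B p * W p)) p) (c : 𝔸) :
    HasFDerivAt (fun q => W q * c) (pairCLM (A p * (W p * c)) (B p * (W p * c))) p := by
  have h1 := hW.mul_const' c
  refine h1.congr_fderiv ?_
  ext <;> simp [mul_assoc]

/-- The fundamental solution of a flat linear system over a simply connected open set. -/
theorem exists_solution_of_flat [CompleteSpace 𝔸] {D : Set (ℝ × ℝ)} (hD : IsOpen D)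
    (hsc : IsSimplyConnected D) {A B : ℝ × ℝ → 𝔸} (hA : ContDiffOn ℝ ∞ A D)
    (hB : ContDiffOn ℝ ∞ B D)
    (hflat : ∀ p ∈ D, dv A p + A p * B p = du B p + B p * A p) {p₀ : ℝ × ℝ} (hp₀ : p₀ ∈ D) :
    ∃ W : ℝ × ℝ → 𝔸, W p₀ = 1 ∧
      ∀ p ∈ D, HasFDerivAt W (pairCLM (A p * W p) (B p * W p)) p := by
  classical
  have : SimplyConnectedSpace D := hsc
  have : LocallyPathConnectedSpace D := hD.locallyPathConnectedSpace
  have hloc : ∀ i : D, ∃ ρ > 0, Metric.ball (i : ℝ × ℝ) ρ ⊆ D ∧ ∃ W : ℝ × ℝ → 𝔸,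
      ∀ p ∈ Metric.ball (i : ℝ × ℝ) ρ,
        IsUnit (W p) ∧ HasFDerivAt W (pairCLM (A p * W p) (B p * W p)) p := by
    intro i
    obtain ⟨ρ, hρ, hsub, W, hW1, hW⟩ := exists_local_solution_of_flat hD hA hB hflat i.2
    -- The local solution is `1` at the centre and units form an open set, so it is invertible on a
    -- smaller ball.
    have hu : ∀ᶠ p in 𝓝 (i : ℝ × ℝ), IsUnit (W p) :=
      (hW i (Metric.mem_ball_self hρ)).continuousAt.eventually
        (Units.isOpen.mem_nhds (by rw [hW1]; exact isUnit_one))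
    obtain ⟨r, hr, hball⟩ := Metric.eventually_nhds_iff_ball.1 hu
    refine ⟨min r ρ, lt_min hr hρ, (Metric.ball_subset_ball (min_le_right _ _)).trans hsub, W,
      fun p hp => ⟨hball p (Metric.ball_subset_ball (min_le_left _ _) hp),
        hW p (Metric.ball_subset_ball (min_le_right _ _) hp)⟩⟩
  choose ρ hρ hsub W hW using hloc
  let f : D → D → 𝔸ˣ := fun i x => if h : IsUnit (W i x) then h.unit else 1
  have hfW : ∀ i x : D, (x : ℝ × ℝ) ∈ Metric.ball (i : ℝ × ℝ) (ρ i) → (f i x : 𝔸) = W i x := by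
    intro i x hx
    simp [f, (hW i x hx).1]
  -- Two solutions differ by a constant right factor: the derivative of `W_j⁻¹ W_i` is `-W_j⁻¹ A W_i
  -- + W_j⁻¹ A W_i = 0` in `u`, and likewise with `B` in `v`.
  have hlc : ∀ i j : D, ∀ x ∈ Metric.ball (i : ℝ × ℝ) (ρ i) ∩ Metric.ball (j : ℝ × ℝ) (ρ j),
      ∀ᶠ y in 𝓝 x, Ring.inverse (W j y) * W i y = Ring.inverse (W j x) * W i x := by
    intro i j x hx
    obtain ⟨r, hr, hball⟩ := Metric.isOpen_iff.1
      (Metric.isOpen_ball.inter Metric.isOpen_ball) x hx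
    have hd : ∀ y ∈ Metric.ball x r,
        HasFDerivAt (fun y => Ring.inverse (W j y) * W i y) (0 : ℝ × ℝ →L[ℝ] 𝔸) y := by
      intro y hy
      obtain ⟨hyi, hyj⟩ := hball hy
      obtain ⟨⟨w, hw⟩, hWj⟩ := hW j y hyj
      obtain ⟨-, hWi⟩ := hW i y hyi
      have h1 : HasFDerivAt Ring.inverse _ (W j y) := hw ▸ hasFDerivAt_ringInverse (𝕜 := ℝ) w
      have h2 := (h1.comp y hWj).mul' hWi
      refine h2.congr_fderiv ?_
      ext <;> simp [← hw, mul_assoc]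
    filter_upwards [Metric.ball_mem_nhds x hr] with y hy
    exact Metric.isOpen_ball.is_const_of_fderiv_eq_zero
      (convex_ball x r).isPreconnected (fun z hz => (hd z hz).differentiableAt.differentiableWithinAt)
      (fun z hz => (hd z hz).fderiv) hy (Metric.mem_ball_self hr)
  obtain ⟨F, hF⟩ := exists_global_of_locally_const (Γ := 𝔸ˣ)
    (fun i : D => (Subtype.val ⁻¹' Metric.ball (i : ℝ × ℝ) (ρ i) : Set D))
    (fun i => Metric.isOpen_ball.preimage continuous_subtype_val) id
    (fun i => Metric.mem_ball_self (hρ i)) f (by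
      rintro i j x ⟨hxi, hxj⟩
      have h1 := (continuous_subtype_val.tendsto x).eventually (hlc i j x ⟨hxi, hxj⟩)
      have h2 : ∀ᶠ y : D in 𝓝 x, (y : ℝ × ℝ) ∈ Metric.ball (i : ℝ × ℝ) (ρ i) :=
        (Metric.isOpen_ball.preimage continuous_subtype_val).mem_nhds hxi
      have h3 : ∀ᶠ y : D in 𝓝 x, (y : ℝ × ℝ) ∈ Metric.ball (j : ℝ × ℝ) (ρ j) :=
        (Metric.isOpen_ball.preimage continuous_subtype_val).mem_nhds hxj
      filter_upwards [h1, h2, h3] with y hy hyi hyj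
      rw [← hfW i y hyi, ← hfW j y hyj, ← hfW i x hxi, ← hfW j x hxj] at hy
      rw [Ring.inverse_unit, Ring.inverse_unit] at hy
      ext
      exact_mod_cast hy)
  let F₀ : ℝ × ℝ → 𝔸 := fun p => if h : p ∈ D then (F ⟨p, h⟩ : 𝔸) else 1
  have hF₀ : ∀ p ∈ D, HasFDerivAt F₀ (pairCLM (A p * F₀ p) (B p * F₀ p)) p := by
    intro p hp
    let i : D := ⟨p, hp⟩
    have hii := Metric.mem_ball_self (x := p) (hρ i)
    have h1 := hF i i hii
    rw [nhds_subtype_eq_comap, eventually_comap] at h1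
    have h2 : F₀ =ᶠ[𝓝 p] fun q => W i q * (((f i i)⁻¹ * F i : 𝔸ˣ) : 𝔸) := by
      filter_upwards [h1, hD.mem_nhds hp, Metric.ball_mem_nhds p (hρ i)] with q hq hqD hqb
      have h3 := hq ⟨q, hqD⟩ rfl
      rw [← h3, Units.val_mul, ← hfW i ⟨q, hqD⟩ hqb, Units.mul_inv_cancel_left]
      simp [F₀, hqD]
    have h4 := hasFDerivAt_mul_const_of_system (hW i p hii).2 (((f i i)⁻¹ * F i : 𝔸ˣ) : 𝔸)
    rw [h2.eq_of_nhds]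
    exact h4.congr_of_eventuallyEq h2
  -- Right multiplication by a constant preserves the system, so the value at `p₀` can be
  -- normalized.
  refine ⟨fun p => F₀ p * ((F ⟨p₀, hp₀⟩)⁻¹ : 𝔸ˣ), by simp [F₀, hp₀], fun p hp => ?_⟩
  exact hasFDerivAt_mul_const_of_system (hF₀ p hp) _

/-- Bootstrap: if `W` is of class `C^n`, so is its derivative `(A W, B W)`, whence `W` is of class
`C^(n+1)`. -/
theorem contDiffOn_of_hasFDerivAt_system {D : Set (ℝ × ℝ)} (hD : IsOpen D)
    {A B W : ℝ × ℝ → 𝔸} (hA : ContDiffOn ℝ ∞ A D) (hB : ContDiffOn ℝ ∞ B D)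
    (hW : ∀ p ∈ D, HasFDerivAt W (pairCLM (A p * W p) (B p * W p)) p) :
    ContDiffOn ℝ ∞ W D := by
  rw [contDiffOn_infty]
  intro n
  induction n with
  | zero =>
    exact contDiffOn_zero.2 fun p hp => (hW p hp).continuousAt.continuousWithinAt
  | succ n ih =>
    push_cast
    rw [contDiffOn_succ_iff_fderiv_of_isOpen hD]
    refine ⟨fun p hp => (hW p hp).differentiableAt.differentiableWithinAt, by simp, ?_⟩
    have hn : ((n : ℕ∞) : WithTop ℕ∞) ≤ ∞ := by norm_cast; exact le_top
    have h1 : ContDiffOn ℝ n (fun p => pairCLM (A p * W p) (B p * W p)) D := by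
      have ha := (hA.of_le hn).mul ih
      have hb := (hB.of_le hn).mul ih
      have e : ∀ p, pairCLM (A p * W p) (B p * W p)
        = (ContinuousLinearMap.fst ℝ ℝ ℝ).smulRight (A p * W p)
          + (ContinuousLinearMap.snd ℝ ℝ ℝ).smulRight (B p * W p) := by
        intro p; ext <;> simp
      simp only [e]
      exact (contDiffOn_const.smulRight ha).add (contDiffOn_const.smulRight hb)
    exact h1.congr fun p hp => (hW p hp).fderiv

end Frobenius

/-! ### Moving frames and their matrices. -/

section Frames

open Set Filter Topology

/-- `(X, Y, l)` solves the derivation equations of an orthonormal frame adapted to the principal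
lines, with coefficients `a = ⟨X_u, Y⟩`, `b = ⟨X_u, l⟩`, `a' = ⟨X_v, Y⟩`, `c = ⟨Y_v, l⟩`. -/
structure IsFrameOn (D : Set (ℝ × ℝ)) (a b a' c : ℝ × ℝ → ℝ) (X Y l : ℝ × ℝ → E3) : Prop where
  deriv_X : ∀ p ∈ D, HasFDerivAt X (pairCLM (a p • Y p + b p • l p) (a' p • Y p)) p
  deriv_Y : ∀ p ∈ D, HasFDerivAt Y (pairCLM (-(a p • X p)) (-(a' p • X p) + c p • l p)) p
  deriv_l : ∀ p ∈ D, HasFDerivAt l (pairCLM (-(b p • X p)) (-(c p • Y p))) p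

/-- The matrix whose rows are `X`, `Y`, `l`. -/
def frameMatrix (X Y l : E3) : Matrix (Fin 3) (Fin 3) ℝ := Matrix.of ![X.ofLp, Y.ofLp, l.ofLp]

theorem hasFDerivAt_coord {X : ℝ × ℝ → E3} {a b : E3} {p : ℝ × ℝ}
    (h : HasFDerivAt X (pairCLM a b) p) (j : Fin 3) :
    HasFDerivAt (fun q => X q j) (pairCLM (a j) (b j)) p := by
  have h1 := (EuclideanSpace.proj (𝕜 := ℝ) j : E3 →L[ℝ] ℝ).hasFDerivAt.comp p h
  refine (h1.congr_fderiv ?_)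
  ext <;> simp

/-- Both frame matrices satisfy `R_u = Ω R` with the same antisymmetric `Ω`, so `(Rᵀ R')_u = Rᵀ (Ωᵀ
+ Ω) R' = 0`, and likewise in `v`. A frame paired with itself gives orthonormality; two different
frames give uniqueness. -/
theorem IsFrameOn.transpose_mul_const {D : Set (ℝ × ℝ)} (hD : IsOpen D) (hc : IsPreconnected D)
    {a b a' c : ℝ × ℝ → ℝ} {X Y l X' Y' l' : ℝ × ℝ → E3} (h : IsFrameOn D a b a' c X Y l)
    (h' : IsFrameOn D a b a' c X' Y' l') {p q : ℝ × ℝ} (hp : p ∈ D) (hq : q ∈ D) :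
    (frameMatrix (X p) (Y p) (l p)).transpose * frameMatrix (X' p) (Y' p) (l' p)
      = (frameMatrix (X q) (Y q) (l q)).transpose * frameMatrix (X' q) (Y' q) (l' q) := by
  ext j k
  have hd : ∀ r ∈ D, HasFDerivAt
      (fun r => X r j * X' r k + Y r j * Y' r k + l r j * l' r k) (0 : ℝ × ℝ →L[ℝ] ℝ) r := by
    intro r hr
    have h1 := ((hasFDerivAt_coord (h.deriv_X r hr) j).mul (hasFDerivAt_coord (h'.deriv_X r hr) k))
    have h2 := ((hasFDerivAt_coord (h.deriv_Y r hr) j).mul (hasFDerivAt_coord (h'.deriv_Y r hr) k))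
    have h3 := ((hasFDerivAt_coord (h.deriv_l r hr) j).mul (hasFDerivAt_coord (h'.deriv_l r hr) k))
    refine ((h1.fun_add h2).fun_add h3).congr_fderiv ?_
    ext <;> simp <;> ring
  have := hD.is_const_of_fderiv_eq_zero hc
    (fun r hr => (hd r hr).differentiableAt.differentiableWithinAt)
    (fun r hr => (hd r hr).fderiv) hp hq
  simpa [frameMatrix, Matrix.mul_apply, Fin.sum_univ_three] using this

theorem frameMatrix_mul_transpose (X Y l : E3) :
    frameMatrix X Y l * (frameMatrix X Y l).transpose
      = !![inner ℝ X X, inner ℝ X Y, inner ℝ X l; inner ℝ Y X, inner ℝ Y Y, inner ℝ Y l;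
          inner ℝ l X, inner ℝ l Y, inner ℝ l l] := by
  ext i j
  fin_cases i <;> fin_cases j <;>
    simp [frameMatrix, Matrix.mul_apply, Fin.sum_univ_three, PiLp.inner_apply, mul_comm,
      -inner_self_eq_norm_sq_to_K]

theorem frameMatrix_det (X Y l : E3) :
    (frameMatrix X Y l).det = inner ℝ (cross X Y) l := by
  rw [Matrix.det_fin_three]
  simp [frameMatrix, cross, crossProduct, PiLp.inner_apply, Fin.sum_univ_three]
  ring

/-- For a rotation the adjugate equals the transpose; comparing last columns gives `X × Y` on one
side and `l` on the other. -/
theorem cross_eq_of_frameMatrix {X Y l : E3}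
    (h : frameMatrix X Y l * (frameMatrix X Y l).transpose = 1) (hdet : (frameMatrix X Y l).det = 1) :
    cross X Y = l := by
  have h1 : (frameMatrix X Y l).adjugate = (frameMatrix X Y l).transpose := by
    have h2 : (frameMatrix X Y l).adjugate * (frameMatrix X Y l
        * (frameMatrix X Y l).transpose) = (frameMatrix X Y l).transpose := by
      rw [← Matrix.mul_assoc, Matrix.adjugate_mul, hdet, one_smul, one_mul]
    rwa [h, mul_one] at h2
  rw [Matrix.adjugate_fin_three] at h1
  ext i
  have h2 := congrFun (congrFun h1 i) 2
  fin_cases i <;> simp [frameMatrix, cross, crossProduct] at h2 ⊢ <;> linarith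

end Frames

/-! ### Integration of the position together with its frame. -/

section FrameExistence

open Set Filter Topology ContinuousLinearMap

/-- The space of quadruples (position, frame). -/
abbrev Quad : Type := E3 × E3 × E3 × E3

/-- The quadruple of four linear functions on `Quad`. -/
noncomputable def quadMap (f g h k : Quad →L[ℝ] E3) : Quad →L[ℝ] Quad := f.prod (g.prod (h.prod k))

/-- The `X`-component. -/
noncomputable def quadX : Quad →L[ℝ] E3 := (fst ℝ E3 (E3 × E3)).comp (snd ℝ E3 (E3 × E3 × E3))

/-- The `Y`-component. -/
noncomputable def quadY : Quad →L[ℝ] E3 :=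
  (fst ℝ E3 E3).comp ((snd ℝ E3 (E3 × E3)).comp (snd ℝ E3 (E3 × E3 × E3)))

/-- The `l`-component. -/
noncomputable def quadL : Quad →L[ℝ] E3 :=
  (snd ℝ E3 E3).comp ((snd ℝ E3 (E3 × E3)).comp (snd ℝ E3 (E3 × E3 × E3)))

@[simp] theorem quadMap_apply (f g h k : Quad →L[ℝ] E3) (w : Quad) :
    quadMap f g h k w = (f w, g w, h w, k w) := rfl

@[simp] theorem quadX_apply (w : Quad) : quadX w = w.2.1 := rfl

@[simp] theorem quadY_apply (w : Quad) : quadY w = w.2.2.1 := rfl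

@[simp] theorem quadL_apply (w : Quad) : quadL w = w.2.2.2 := rfl

theorem hasFDerivAt_smul_const_sum {V : Type*} [NormedAddCommGroup V] [NormedSpace ℝ V]
    {f g h : ℝ × ℝ → ℝ} {D : Set (ℝ × ℝ)} (hD : IsOpen D)
    (hf : ContDiffOn ℝ ∞ f D) (hg : ContDiffOn ℝ ∞ g D) (hh : ContDiffOn ℝ ∞ h D)
    (S T U : V) {p : ℝ × ℝ} (hp : p ∈ D) :
    HasFDerivAt (fun q => f q • S + g q • T + h q • U)
      (pairCLM (du f p • S + du g p • T + du h p • U) (dv f p • S + dv g p • T + dv h p • U)) p := by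
  have h1 := (hasFDerivAt_pairCLM (differentiableAt_of_contDiffOn hD hf hp)).smul_const S
  have h2 := (hasFDerivAt_pairCLM (differentiableAt_of_contDiffOn hD hg hp)).smul_const T
  have h3 := (hasFDerivAt_pairCLM (differentiableAt_of_contDiffOn hD hh hp)).smul_const U
  refine ((h1.fun_add h2).fun_add h3).congr_fderiv ?_
  ext <;> simp

theorem exists_position_and_frame {D : Set (ℝ × ℝ)} (hD : IsOpen D) (hsc : IsSimplyConnected D)
    {P Q a b a' c : ℝ × ℝ → ℝ} (hP : ContDiffOn ℝ ∞ P D) (hQ : ContDiffOn ℝ ∞ Q D)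
    (ha : ContDiffOn ℝ ∞ a D) (hb : ContDiffOn ℝ ∞ b D) (ha' : ContDiffOn ℝ ∞ a' D)
    (hc : ContDiffOn ℝ ∞ c D) (hPv : ∀ p ∈ D, dv P p = -(Q p * a p))
    (hQu : ∀ p ∈ D, du Q p = P p * a' p)
    (hGauss : ∀ p ∈ D, dv a p - du a' p = b p * c p)
    (hbv : ∀ p ∈ D, dv b p = -(a p * c p)) (hcu : ∀ p ∈ D, du c p = a' p * b p)
    {p₀ : ℝ × ℝ} (hp₀ : p₀ ∈ D) :
    ∃ x X Y l : ℝ × ℝ → E3, ContDiffOn ℝ ∞ x D ∧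
      (∀ p ∈ D, HasFDerivAt x (pairCLM (P p • X p) (Q p • Y p)) p) ∧
      IsFrameOn D a b a' c X Y l ∧ frameMatrix (X p₀) (Y p₀) (l p₀) = 1 := by
  -- Position and frame form one linear system with values in the endomorphisms of `Quad`, so one
  -- flatness condition covers both the frame equations and the closedness of `P X du + Q Y dv`.
  let A : ℝ × ℝ → Quad →L[ℝ] Quad := fun p => P p • quadMap quadX 0 0 0
    + a p • quadMap 0 quadY (-quadX) 0 + b p • quadMap 0 quadL 0 (-quadX)
  let B : ℝ × ℝ → Quad →L[ℝ] Quad := fun p => Q p • quadMap quadY 0 0 0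
    + a' p • quadMap 0 quadY (-quadX) 0 + c p • quadMap 0 0 quadL (-quadY)
  have hA : ContDiffOn ℝ ∞ A D := ((hP.smul contDiffOn_const).add
    (ha.smul contDiffOn_const)).add (hb.smul contDiffOn_const)
  have hB : ContDiffOn ℝ ∞ B D := ((hQ.smul contDiffOn_const).add
    (ha'.smul contDiffOn_const)).add (hc.smul contDiffOn_const)
  have hflat : ∀ p ∈ D, dv A p + A p * B p = du B p + B p * A p := by
    intro p hp
    rw [dv_eq_of_hasFDerivAt (hasFDerivAt_smul_const_sum hD hP ha hb _ _ _ hp),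
      du_eq_of_hasFDerivAt (hasFDerivAt_smul_const_sum hD hQ ha' hc _ _ _ hp)]
    have e1 := hPv p hp
    have e2 := hQu p hp
    have e3 : dv a p = du a' p + b p * c p := by linarith [hGauss p hp]
    have e4 := hbv p hp
    have e5 := hcu p hp
    rw [e1, e2, e3, e4, e5]
    refine ContinuousLinearMap.ext fun w => ?_
    obtain ⟨w₀, w₁, w₂, w₃⟩ := w
    simp only [A, B, _root_.add_apply, _root_.smul_apply,
      mul_apply_eq_comp, quadMap_apply, quadX_apply, quadY_apply, quadL_apply,
      _root_.neg_apply, _root_.zero_apply, Prod.smul_mk, Prod.mk_add_mk,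
      smul_zero, Prod.mk.injEq]
    refine ⟨?_, ?_, ?_, ?_⟩ <;> module
  obtain ⟨W, hW0, hW⟩ := exists_solution_of_flat hD hsc hA hB hflat hp₀
  have hWs := contDiffOn_of_hasFDerivAt_system hD hA hB hW
  -- Initial data: the origin with the standard basis, to which the fundamental solution is applied.
  let w₀ : Quad := (0, EuclideanSpace.single 0 1, EuclideanSpace.single 1 1,
    EuclideanSpace.single 2 1)
  have hd : ∀ p ∈ D, ∀ f : Quad →L[ℝ] E3, HasFDerivAt (fun q => f (W q w₀))
      (pairCLM (f (A p (W p w₀))) (f (B p (W p w₀)))) p := by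
    intro p hp f
    have h1 := ((ContinuousLinearMap.apply ℝ Quad w₀).hasFDerivAt.comp p (hW p hp))
    have h2 := f.hasFDerivAt.comp p h1
    refine h2.congr_fderiv ?_
    ext : 1 <;> ext : 1 <;> simp
  refine ⟨fun p => (W p w₀).1, fun p => (W p w₀).2.1, fun p => (W p w₀).2.2.1,
    fun p => (W p w₀).2.2.2, ?_, fun p hp => ?_, ⟨fun p hp => ?_, fun p hp => ?_,
    fun p hp => ?_⟩, ?_⟩
  · exact (hWs.clm_apply contDiffOn_const).fst
  · simpa [A, B] using hd p hp (fst ℝ E3 _)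
  · simpa [A, B] using hd p hp quadX
  · simpa [A, B] using hd p hp quadY
  · simpa [A, B] using hd p hp quadL
  · ext i j
    fin_cases i <;> fin_cases j <;> simp [hW0, w₀, frameMatrix]

/-- `Rᵀ R` is constant, equal to its value `1` at `p₀`. The determinant is then continuous with
square `1`, hence stays `1` on a connected set. -/
theorem IsFrameOn.orthonormal {D : Set (ℝ × ℝ)} (hD : IsOpen D) (hc : IsPreconnected D)
    {a b a' c : ℝ × ℝ → ℝ} {X Y l : ℝ × ℝ → E3} (h : IsFrameOn D a b a' c X Y l)
    {p₀ : ℝ × ℝ} (hp₀ : p₀ ∈ D) (h0 : frameMatrix (X p₀) (Y p₀) (l p₀) = 1) {p : ℝ × ℝ}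
    (hp : p ∈ D) :
    frameMatrix (X p) (Y p) (l p) * (frameMatrix (X p) (Y p) (l p)).transpose = 1 ∧
      (frameMatrix (X p) (Y p) (l p)).det = 1 := by
  have horth : ∀ q ∈ D,
      frameMatrix (X q) (Y q) (l q) * (frameMatrix (X q) (Y q) (l q)).transpose = 1 := by
    intro q hq
    rw [mul_eq_one_comm, h.transpose_mul_const hD hc h hq hp₀, h0]
    simp
  refine ⟨horth p hp, ?_⟩
  have hcX : ContinuousOn X D := fun q hq => (h.deriv_X q hq).continuousAt.continuousWithinAt
  have hcY : ContinuousOn Y D := fun q hq => (h.deriv_Y q hq).continuousAt.continuousWithinAt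
  have hcl : ContinuousOn l D := fun q hq => (h.deriv_l q hq).continuousAt.continuousWithinAt
  have hcoord : ∀ {Z : ℝ × ℝ → E3}, ContinuousOn Z D → ∀ i, ContinuousOn (fun q => Z q i) D :=
    fun hZ i => (EuclideanSpace.proj (𝕜 := ℝ) i : E3 →L[ℝ] ℝ).continuous.comp_continuousOn hZ
  have hcd : ContinuousOn (fun q => (frameMatrix (X q) (Y q) (l q)).det) D := by
    simp only [Matrix.det_fin_three, frameMatrix]
    have := hcoord hcX
    have := hcoord hcY
    have := hcoord hcl
    simp only [Matrix.of_apply, Matrix.cons_val]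
    fun_prop (disch := assumption)
  have hsq : EqOn ((fun q => (frameMatrix (X q) (Y q) (l q)).det) ^ 2) 1 D := by
    intro q hq
    have := congrArg Matrix.det (horth q hq)
    rw [Matrix.det_mul, Matrix.det_transpose, Matrix.det_one] at this
    simpa [sq] using this
  rcases hc.eq_one_or_eq_neg_one_of_sq_eq hcd hsq with h1 | h1
  · exact h1 hp
  · have := h1 hp₀
    simp only [h0, Matrix.det_one, Pi.neg_apply, Pi.one_apply] at this
    norm_num at this

end FrameExistence

/-! ### Differentiation rules for `du` and `dv`. -/

section PartialRules

variable {V : Type*} [NormedAddCommGroup V] [NormedSpace ℝ V]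

theorem du_mul {f g : ℝ × ℝ → ℝ} {p : ℝ × ℝ} (hf : DifferentiableAt ℝ f p)
    (hg : DifferentiableAt ℝ g p) :
    du (fun q => f q * g q) p = du f p * g p + f p * du g p := by
  simp [du, fderiv_fun_mul hf hg]; ring

theorem dv_mul {f g : ℝ × ℝ → ℝ} {p : ℝ × ℝ} (hf : DifferentiableAt ℝ f p)
    (hg : DifferentiableAt ℝ g p) :
    dv (fun q => f q * g q) p = dv f p * g p + f p * dv g p := by
  simp [dv, fderiv_fun_mul hf hg]; ring

theorem du_sub {f g : ℝ × ℝ → ℝ} {p : ℝ × ℝ} (hf : DifferentiableAt ℝ f p)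
    (hg : DifferentiableAt ℝ g p) : du (fun q => f q - g q) p = du f p - du g p := by
  simp [du, fderiv_fun_sub hf hg]

theorem dv_sub {f g : ℝ × ℝ → ℝ} {p : ℝ × ℝ} (hf : DifferentiableAt ℝ f p)
    (hg : DifferentiableAt ℝ g p) : dv (fun q => f q - g q) p = dv f p - dv g p := by
  simp [dv, fderiv_fun_sub hf hg]

theorem du_sq {f : ℝ × ℝ → ℝ} {p : ℝ × ℝ} (hf : DifferentiableAt ℝ f p) :
    du (fun q => f q ^ 2) p = 2 * f p * du f p := by
  simp only [sq]; rw [du_mul hf hf]; ring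

theorem dv_sq {f : ℝ × ℝ → ℝ} {p : ℝ × ℝ} (hf : DifferentiableAt ℝ f p) :
    dv (fun q => f q ^ 2) p = 2 * f p * dv f p := by
  simp only [sq]; rw [dv_mul hf hf]; ring

theorem du_log {f : ℝ × ℝ → ℝ} {p : ℝ × ℝ} (hf : DifferentiableAt ℝ f p) (h0 : f p ≠ 0) :
    du (fun q => Real.log (f q)) p = du f p / f p := by
  simp [du, fderiv.log hf h0, div_eq_inv_mul]

theorem dv_log {f : ℝ × ℝ → ℝ} {p : ℝ × ℝ} (hf : DifferentiableAt ℝ f p) (h0 : f p ≠ 0) :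
    dv (fun q => Real.log (f q)) p = dv f p / f p := by
  simp [dv, fderiv.log hf h0, div_eq_inv_mul]

theorem du_smul {f : ℝ × ℝ → ℝ} {g : ℝ × ℝ → V} {p : ℝ × ℝ} (hf : DifferentiableAt ℝ f p)
    (hg : DifferentiableAt ℝ g p) :
    du (fun q => f q • g q) p = du f p • g p + f p • du g p := by
  simp [du, fderiv_fun_smul hf hg, add_comm]

theorem dv_smul {f : ℝ × ℝ → ℝ} {g : ℝ × ℝ → V} {p : ℝ × ℝ} (hf : DifferentiableAt ℝ f p)
    (hg : DifferentiableAt ℝ g p) :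
    dv (fun q => f q • g q) p = dv f p • g p + f p • dv g p := by
  simp [dv, fderiv_fun_smul hf hg, add_comm]

theorem du_inner {f g : ℝ × ℝ → E3} {p : ℝ × ℝ} (hf : DifferentiableAt ℝ f p)
    (hg : DifferentiableAt ℝ g p) :
    du (fun q => (inner ℝ (f q) (g q) : ℝ)) p
      = inner ℝ (du f p) (g p) + inner ℝ (f p) (du g p) := by
  rw [du, fderiv_inner_apply ℝ hf hg, add_comm]; rfl

theorem dv_inner {f g : ℝ × ℝ → E3} {p : ℝ × ℝ} (hf : DifferentiableAt ℝ f p)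
    (hg : DifferentiableAt ℝ g p) :
    dv (fun q => (inner ℝ (f q) (g q) : ℝ)) p
      = inner ℝ (dv f p) (g p) + inner ℝ (f p) (dv g p) := by
  rw [dv, fderiv_inner_apply ℝ hf hg, add_comm]; rfl

theorem cross_smul_smul (s t : ℝ) (a b : E3) : cross (s • a) (t • b) = (s * t) • cross a b := by
  ext i
  fin_cases i <;> simp [cross, crossProduct] <;> ring

end PartialRules

/-- The positive square root of the coefficient `E` in terms of the invariants. -/
noncomputable def rootE (ν₁ ν₂ γ₂ : ℝ × ℝ → ℝ) (p : ℝ × ℝ) : ℝ :=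
  du ν₂ p / (γ₂ p * (ν₁ p - ν₂ p))

/-- The positive square root of the coefficient `G` in terms of the invariants. -/
noncomputable def rootG (ν₁ ν₂ γ₁ : ℝ × ℝ → ℝ) (p : ℝ × ℝ) : ℝ :=
  dv ν₁ p / (γ₁ p * (ν₁ p - ν₂ p))

/-- The hypotheses of the invariant Bonnet theorem over `D`. -/
structure IsBonnetData (D : Set (ℝ × ℝ)) (ν₁ ν₂ γ₁ γ₂ : ℝ × ℝ → ℝ) : Prop where
  isOpen : IsOpen D
  smooth_ν₁ : ContDiffOn ℝ ∞ ν₁ D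
  smooth_ν₂ : ContDiffOn ℝ ∞ ν₂ D
  smooth_γ₁ : ContDiffOn ℝ ∞ γ₁ D
  smooth_γ₂ : ContDiffOn ℝ ∞ γ₂ D
  pos : ∀ p ∈ D, 0 < ν₁ p - ν₂ p ∧ 0 < γ₁ p * dv ν₁ p ∧ 0 < γ₂ p * du ν₂ p
  cod₁ : ∀ p ∈ D, du (fun q => Real.log (dv ν₁ q / γ₁ q)) p = du ν₁ p / (ν₁ p - ν₂ p)
  cod₂ : ∀ p ∈ D, dv (fun q => Real.log (du ν₂ q / γ₂ q)) p = -(dv ν₂ p / (ν₁ p - ν₂ p))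
  gauss : ∀ p ∈ D,
    (ν₁ p - ν₂ p) / 2 *
        (dv (fun q => γ₁ q ^ 2) p / dv ν₁ p - du (fun q => γ₂ q ^ 2) p / du ν₂ p) -
      (γ₁ p ^ 2 + γ₂ p ^ 2) = ν₁ p * ν₂ p

/-! ### From the conditions on the invariants to the Gauss and Codazzi equations. -/

namespace IsBonnetData

variable {D : Set (ℝ × ℝ)} {ν₁ ν₂ γ₁ γ₂ : ℝ × ℝ → ℝ} {p : ℝ × ℝ}

theorem γ₁_ne (h : IsBonnetData D ν₁ ν₂ γ₁ γ₂) (hp : p ∈ D) : γ₁ p ≠ 0 := fun h0 => by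
  have := (h.pos p hp).2.1; simp [h0] at this

theorem γ₂_ne (h : IsBonnetData D ν₁ ν₂ γ₁ γ₂) (hp : p ∈ D) : γ₂ p ≠ 0 := fun h0 => by
  have := (h.pos p hp).2.2; simp [h0] at this

theorem sub_ne (h : IsBonnetData D ν₁ ν₂ γ₁ γ₂) (hp : p ∈ D) : ν₁ p - ν₂ p ≠ 0 := (h.pos p hp).1.ne'

/-- Only the product `γ₂ (ν₂)_u` has a known sign, so the fraction is expanded by `γ₂`. -/
theorem rootE_pos (h : IsBonnetData D ν₁ ν₂ γ₁ γ₂) (hp : p ∈ D) : 0 < rootE ν₁ ν₂ γ₂ p := by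
  obtain ⟨h1, -, h3⟩ := h.pos p hp
  have h0 := h.γ₂_ne hp
  have e : rootE ν₁ ν₂ γ₂ p = γ₂ p * du ν₂ p / (γ₂ p ^ 2 * (ν₁ p - ν₂ p)) := by
    rw [rootE]; field_simp
  rw [e]; positivity

theorem rootG_pos (h : IsBonnetData D ν₁ ν₂ γ₁ γ₂) (hp : p ∈ D) : 0 < rootG ν₁ ν₂ γ₁ p := by
  obtain ⟨h1, h2, -⟩ := h.pos p hp
  have h0 := h.γ₁_ne hp
  have e : rootG ν₁ ν₂ γ₁ p = γ₁ p * dv ν₁ p / (γ₁ p ^ 2 * (ν₁ p - ν₂ p)) := by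
    rw [rootG]; field_simp
  rw [e]; positivity

theorem contDiffOn_rootE (h : IsBonnetData D ν₁ ν₂ γ₁ γ₂) : ContDiffOn ℝ ∞ (rootE ν₁ ν₂ γ₂) D :=
  (contDiffOn_du h.isOpen h.smooth_ν₂).div (h.smooth_γ₂.mul (h.smooth_ν₁.sub h.smooth_ν₂))
    fun _ hp => mul_ne_zero (h.γ₂_ne hp) (h.sub_ne hp)

theorem contDiffOn_rootG (h : IsBonnetData D ν₁ ν₂ γ₁ γ₂) : ContDiffOn ℝ ∞ (rootG ν₁ ν₂ γ₁) D :=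
  (contDiffOn_dv h.isOpen h.smooth_ν₁).div (h.smooth_γ₁.mul (h.smooth_ν₁.sub h.smooth_ν₂))
    fun _ hp => mul_ne_zero (h.γ₁_ne hp) (h.sub_ne hp)

theorem dv_ν₁ (h : IsBonnetData D ν₁ ν₂ γ₁ γ₂) (hp : p ∈ D) : dv ν₁ p = γ₁ p * rootG ν₁ ν₂ γ₁ p * (ν₁ p - ν₂ p) := by
  have := h.γ₁_ne hp
  have := h.sub_ne hp
  rw [rootG]; field_simp

theorem du_ν₂ (h : IsBonnetData D ν₁ ν₂ γ₁ γ₂) (hp : p ∈ D) : du ν₂ p = γ₂ p * rootE ν₁ ν₂ γ₂ p * (ν₁ p - ν₂ p) := by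
  have := h.γ₂_ne hp
  have := h.sub_ne hp
  rw [rootE]; field_simp

/-- Since `(ν₁)_v / γ₁ = Q (ν₁ - ν₂)`, the first logarithmic equation gives `Q_u / Q = (ν₁)_u / (ν₁
- ν₂) - (ν₁ - ν₂)_u / (ν₁ - ν₂) = (ν₂)_u / (ν₁ - ν₂) = γ₂ P`. -/
theorem du_rootG (h : IsBonnetData D ν₁ ν₂ γ₁ γ₂) (hp : p ∈ D) :
    du (rootG ν₁ ν₂ γ₁) p = rootE ν₁ ν₂ γ₂ p * (γ₂ p * rootG ν₁ ν₂ γ₁ p) := by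
  have d1 := differentiableAt_of_contDiffOn h.isOpen h.smooth_ν₁ hp
  have d2 := differentiableAt_of_contDiffOn h.isOpen h.smooth_ν₂ hp
  have dG := differentiableAt_of_contDiffOn h.isOpen h.contDiffOn_rootG hp
  have hδ := h.sub_ne hp
  have hG := (h.rootG_pos hp).ne'
  have e1 := h.cod₁ p hp
  rw [du_congr (g := fun q => Real.log (rootG ν₁ ν₂ γ₁ q * (ν₁ q - ν₂ q))) h.isOpen
    (fun q hq => by
      have := h.γ₁_ne hq
      rw [h.dv_ν₁ hq]; congr 1; field_simp) hp,
    du_log (dG.fun_mul (d1.fun_sub d2)) (mul_ne_zero hG hδ), du_mul dG (d1.fun_sub d2), du_sub d1 d2,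
    h.du_ν₂ hp] at e1
  field_simp at e1
  apply mul_right_cancel₀ hδ
  linear_combination e1

theorem dv_rootE (h : IsBonnetData D ν₁ ν₂ γ₁ γ₂) (hp : p ∈ D) :
    dv (rootE ν₁ ν₂ γ₂) p = -(rootG ν₁ ν₂ γ₁ p * (γ₁ p * rootE ν₁ ν₂ γ₂ p)) := by
  have d1 := differentiableAt_of_contDiffOn h.isOpen h.smooth_ν₁ hp
  have d2 := differentiableAt_of_contDiffOn h.isOpen h.smooth_ν₂ hp
  have dE := differentiableAt_of_contDiffOn h.isOpen h.contDiffOn_rootE hp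
  have hδ := h.sub_ne hp
  have hE := (h.rootE_pos hp).ne'
  have e1 := h.cod₂ p hp
  rw [dv_congr (g := fun q => Real.log (rootE ν₁ ν₂ γ₂ q * (ν₁ q - ν₂ q))) h.isOpen
    (fun q hq => by
      have := h.γ₂_ne hq
      rw [h.du_ν₂ hq]; congr 1; field_simp) hp,
    dv_log (dE.fun_mul (d1.fun_sub d2)) (mul_ne_zero hE hδ), dv_mul dE (d1.fun_sub d2), dv_sub d1 d2,
    h.dv_ν₁ hp] at e1
  field_simp at e1
  apply mul_right_cancel₀ hδ
  linear_combination e1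

/-- After substituting for `(ν₁)_v` and `(ν₂)_u`, condition 2.2 reads `(γ₁)_v / Q - (γ₂)_u / P -
(γ₁² + γ₂²) = ν₁ ν₂`; multiplied by `P Q` it is the claim expanded by the product rule. -/
theorem gauss_frame (h : IsBonnetData D ν₁ ν₂ γ₁ γ₂) (hp : p ∈ D) :
    dv (fun q => γ₁ q * rootE ν₁ ν₂ γ₂ q) p - du (fun q => γ₂ q * rootG ν₁ ν₂ γ₁ q) p
      = (ν₁ p * rootE ν₁ ν₂ γ₂ p) * (ν₂ p * rootG ν₁ ν₂ γ₁ p) := by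
  have g1 := differentiableAt_of_contDiffOn h.isOpen h.smooth_γ₁ hp
  have g2 := differentiableAt_of_contDiffOn h.isOpen h.smooth_γ₂ hp
  have dE := differentiableAt_of_contDiffOn h.isOpen h.contDiffOn_rootE hp
  have dG := differentiableAt_of_contDiffOn h.isOpen h.contDiffOn_rootG hp
  have hδ := h.sub_ne hp
  have hE := (h.rootE_pos hp).ne'
  have hG := (h.rootG_pos hp).ne'
  have n1 := h.γ₁_ne hp
  have n2 := h.γ₂_ne hp
  have e1 := h.gauss p hp
  rw [dv_sq g1, du_sq g2, h.dv_ν₁ hp, h.du_ν₂ hp] at e1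
  rw [dv_mul g1 dE, du_mul g2 dG, h.dv_rootE hp, h.du_rootG hp]
  have e2 : (ν₁ p - ν₂ p) / 2 * (2 * γ₁ p * dv γ₁ p / (γ₁ p * rootG ν₁ ν₂ γ₁ p * (ν₁ p - ν₂ p))
      - 2 * γ₂ p * du γ₂ p / (γ₂ p * rootE ν₁ ν₂ γ₂ p * (ν₁ p - ν₂ p)))
      = dv γ₁ p / rootG ν₁ ν₂ γ₁ p - du γ₂ p / rootE ν₁ ν₂ γ₂ p := by
    field_simp
  rw [e2] at e1
  field_simp at e1
  linear_combination e1

theorem dv_ν₁_mul_rootE (h : IsBonnetData D ν₁ ν₂ γ₁ γ₂) (hp : p ∈ D) : dv (fun q => ν₁ q * rootE ν₁ ν₂ γ₂ q) p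
    = -((γ₁ p * rootE ν₁ ν₂ γ₂ p) * (ν₂ p * rootG ν₁ ν₂ γ₁ p)) := by
  rw [dv_mul (differentiableAt_of_contDiffOn h.isOpen h.smooth_ν₁ hp)
    (differentiableAt_of_contDiffOn h.isOpen h.contDiffOn_rootE hp), h.dv_rootE hp, h.dv_ν₁ hp]
  ring

theorem du_ν₂_mul_rootG (h : IsBonnetData D ν₁ ν₂ γ₁ γ₂) (hp : p ∈ D) : du (fun q => ν₂ q * rootG ν₁ ν₂ γ₁ q) p
    = (γ₂ p * rootG ν₁ ν₂ γ₁ p) * (ν₁ p * rootE ν₁ ν₂ γ₂ p) := by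
  rw [du_mul (differentiableAt_of_contDiffOn h.isOpen h.smooth_ν₂ hp)
    (differentiableAt_of_contDiffOn h.isOpen h.contDiffOn_rootG hp), h.du_rootG hp, h.du_ν₂ hp]
  ring

theorem mono (h : IsBonnetData D ν₁ ν₂ γ₁ γ₂) {D' : Set (ℝ × ℝ)} (hD' : IsOpen D') (hsub : D' ⊆ D) :
    IsBonnetData D' ν₁ ν₂ γ₁ γ₂ :=
  ⟨hD', h.smooth_ν₁.mono hsub, h.smooth_ν₂.mono hsub, h.smooth_γ₁.mono hsub,
    h.smooth_γ₂.mono hsub, fun p hp => h.pos p (hsub hp), fun p hp => h.cod₁ p (hsub hp),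
    fun p hp => h.cod₂ p (hsub hp), fun p hp => h.gauss p (hsub hp)⟩

end IsBonnetData

/-! ### A solution of the frame equations is a surface with the given invariants. -/

section Realization

open Set Filter Topology

/-- Scalar products in a right oriented orthonormal frame. -/
structure IsRightFrame (X Y l : E3) : Prop where
  XX : (inner ℝ X X : ℝ) = 1
  YY : (inner ℝ Y Y : ℝ) = 1
  ll : (inner ℝ l l : ℝ) = 1
  XY : (inner ℝ X Y : ℝ) = 0
  Xl : (inner ℝ X l : ℝ) = 0
  Yl : (inner ℝ Y l : ℝ) = 0
  cross_eq : cross X Y = l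

theorem IsRightFrame.YX {X Y l : E3} (h : IsRightFrame X Y l) : (inner ℝ Y X : ℝ) = 0 := by
  rw [real_inner_comm]; exact h.XY

theorem IsRightFrame.lX {X Y l : E3} (h : IsRightFrame X Y l) : (inner ℝ l X : ℝ) = 0 := by
  rw [real_inner_comm]; exact h.Xl

theorem IsRightFrame.lY {X Y l : E3} (h : IsRightFrame X Y l) : (inner ℝ l Y : ℝ) = 0 := by
  rw [real_inner_comm]; exact h.Yl

theorem IsRightFrame.mul_transpose {X Y l : E3} (h : IsRightFrame X Y l) :
    frameMatrix X Y l * (frameMatrix X Y l).transpose = 1 := by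
  rw [frameMatrix_mul_transpose, h.XX, h.XY, h.Xl, h.YX, h.YY, h.Yl, h.lX, h.lY, h.ll]
  ext i j
  fin_cases i <;> fin_cases j <;> rfl

theorem IsRightFrame.det {X Y l : E3} (h : IsRightFrame X Y l) : (frameMatrix X Y l).det = 1 := by
  rw [frameMatrix_det, h.cross_eq, h.ll]

theorem isRightFrame_of_frameMatrix {X Y l : E3}
    (h : frameMatrix X Y l * (frameMatrix X Y l).transpose = 1)
    (hdet : (frameMatrix X Y l).det = 1) : IsRightFrame X Y l := by
  have e := h
  rw [frameMatrix_mul_transpose] at e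
  have e' := fun i j => congrFun (congrFun e i) j
  exact ⟨by simpa using! e' 0 0, by simpa using! e' 1 1, by simpa using! e' 2 2, by simpa using! e' 0 1,
    by simpa using! e' 0 2, by simpa using! e' 1 2, cross_eq_of_frameMatrix h hdet⟩

theorem IsRightFrame.expand {X Y l : E3} (h : IsRightFrame X Y l) (z : E3) :
    z = (inner ℝ z X : ℝ) • X + (inner ℝ z Y : ℝ) • Y + (inner ℝ z l : ℝ) • l := by
  have h1 : (frameMatrix X Y l).transpose * frameMatrix X Y l = 1 :=
    mul_eq_one_comm.1 h.mul_transpose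
  ext k
  have e : ∀ j, X j * X k + Y j * Y k + l j * l k = (1 : Matrix (Fin 3) (Fin 3) ℝ) j k := by
    intro j
    rw [← h1]
    simp [frameMatrix, Matrix.mul_apply, Fin.sum_univ_three]
  have e0 := e 0
  have e1 := e 1
  have e2 := e 2
  have hz : z k = z 0 * (1 : Matrix (Fin 3) (Fin 3) ℝ) 0 k
      + z 1 * (1 : Matrix (Fin 3) (Fin 3) ℝ) 1 k + z 2 * (1 : Matrix (Fin 3) (Fin 3) ℝ) 2 k := by
    fin_cases k <;> simp [Matrix.one_apply]
  rw [hz, ← e0, ← e1, ← e2]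
  simp [PiLp.inner_apply, Fin.sum_univ_three]
  ring

/-- A principal parametrization together with its moving frame realizes the prescribed
coefficients. -/
theorem isStronglyRegularSurface_of_frame {D : Set (ℝ × ℝ)} (hD : IsOpen D)
    {P Q ν₁ ν₂ γ₁ γ₂ : ℝ × ℝ → ℝ} {x X Y l : ℝ × ℝ → E3} (hxs : ContDiffOn ℝ ∞ x D)
    (hP : ContDiffOn ℝ ∞ P D) (hQ : ContDiffOn ℝ ∞ Q D)
    (hPpos : ∀ p ∈ D, 0 < P p) (hQpos : ∀ p ∈ D, 0 < Q p)
    (hPv : ∀ p ∈ D, dv P p = -(Q p * (γ₁ p * P p)))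
    (hQu : ∀ p ∈ D, du Q p = P p * (γ₂ p * Q p))
    (hx : ∀ p ∈ D, HasFDerivAt x (pairCLM (P p • X p) (Q p • Y p)) p)
    (hF : IsFrameOn D (fun p => γ₁ p * P p) (fun p => ν₁ p * P p) (fun p => γ₂ p * Q p)
      (fun p => ν₂ p * Q p) X Y l)
    (hR : ∀ p ∈ D, IsRightFrame (X p) (Y p) (l p))
    (hstrong : ∀ p ∈ D, (ν₁ p - ν₂ p) * γ₁ p * γ₂ p ≠ 0) :
    IsStronglyRegularSurface D x ∧ HasInvariants D x ν₁ ν₂ γ₁ γ₂ := by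
  have xu : ∀ p ∈ D, du x p = P p • X p := fun p hp => du_eq_of_hasFDerivAt (hx p hp)
  have xv : ∀ p ∈ D, dv x p = Q p • Y p := fun p hp => dv_eq_of_hasFDerivAt (hx p hp)
  have dP := fun p (hp : p ∈ D) => differentiableAt_of_contDiffOn hD hP hp
  have dQ := fun p (hp : p ∈ D) => differentiableAt_of_contDiffOn hD hQ hp
  have xuu : ∀ p ∈ D, du (du x) p
      = du P p • X p + P p • ((γ₁ p * P p) • Y p + (ν₁ p * P p) • l p) := by
    intro p hp
    rw [du_congr hD xu hp, du_smul (dP p hp) (hF.deriv_X p hp).differentiableAt,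
      du_eq_of_hasFDerivAt (hF.deriv_X p hp)]
  have xuv : ∀ p ∈ D, dv (du x) p = dv P p • X p + P p • ((γ₂ p * Q p) • Y p) := by
    intro p hp
    rw [dv_congr hD xu hp, dv_smul (dP p hp) (hF.deriv_X p hp).differentiableAt,
      dv_eq_of_hasFDerivAt (hF.deriv_X p hp)]
  have xvv : ∀ p ∈ D, dv (dv x) p
      = dv Q p • Y p + Q p • (-((γ₂ p * Q p) • X p) + (ν₂ p * Q p) • l p) := by
    intro p hp
    rw [dv_congr hD xv hp, dv_smul (dQ p hp) (hF.deriv_Y p hp).differentiableAt,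
      dv_eq_of_hasFDerivAt (hF.deriv_Y p hp)]
  have hE : ∀ p ∈ D, formE x p = P p ^ 2 := by
    intro p hp
    rw [formE, xu p hp, real_inner_smul_left, real_inner_smul_right, (hR p hp).XX]; ring
  have hFF : ∀ p ∈ D, formF x p = 0 := by
    intro p hp
    rw [formF, xu p hp, xv p hp, real_inner_smul_left, real_inner_smul_right, (hR p hp).XY]; ring
  have hG : ∀ p ∈ D, formG x p = Q p ^ 2 := by
    intro p hp
    rw [formG, xv p hp, real_inner_smul_left, real_inner_smul_right, (hR p hp).YY]; ring
  have hn : ∀ p ∈ D, unitNormal x p = l p := by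
    intro p hp
    have hPQ : 0 < P p * Q p := mul_pos (hPpos p hp) (hQpos p hp)
    have hl : ‖l p‖ = 1 := by
      have := (hR p hp).ll
      rw [real_inner_self_eq_norm_sq] at this
      nlinarith [norm_nonneg (l p)]
    rw [unitNormal, xu p hp, xv p hp, cross_smul_smul, (hR p hp).cross_eq, norm_smul, hl, mul_one,
      Real.norm_of_nonneg hPQ.le, smul_smul, inv_mul_cancel₀ hPQ.ne', one_smul]
  have hL : ∀ p ∈ D, formL x p = ν₁ p * P p ^ 2 := by
    intro p hp
    have r := hR p hp
    rw [formL, hn p hp, xuu p hp]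
    simp only [inner_add_left, real_inner_smul_left, r.Xl, r.Yl, r.ll]; ring
  have hM : ∀ p ∈ D, formM x p = 0 := by
    intro p hp
    have r := hR p hp
    rw [formM, hn p hp, xuv p hp]
    simp only [inner_add_left, real_inner_smul_left, r.Xl, r.Yl]; ring
  have hN : ∀ p ∈ D, formN x p = ν₂ p * Q p ^ 2 := by
    intro p hp
    have r := hR p hp
    rw [formN, hn p hp, xvv p hp]
    simp only [inner_add_left, inner_neg_left, real_inner_smul_left, r.Xl, r.Yl, r.ll]; ring
  have hinv : HasInvariants D x ν₁ ν₂ γ₁ γ₂ := by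
    intro p hp
    have hP0 := hPpos p hp
    have hQ0 := hQpos p hp
    refine ⟨?_, ?_, ?_, ?_⟩
    · rw [nu1, hL p hp, hE p hp]; field_simp
    · rw [nu2, hN p hp, hG p hp]; field_simp
    · rw [gamma1, dv_congr hD hE hp, dv_sq (dP p hp), hE p hp, hG p hp, Real.sqrt_sq hQ0.le,
        hPv p hp]
      field_simp
    · rw [gamma2, du_congr hD hG hp, du_sq (dQ p hp), hE p hp, hG p hp, Real.sqrt_sq hP0.le,
        hQu p hp]
      field_simp
  refine ⟨⟨hxs, fun p hp => ?_, fun p hp => ⟨hFF p hp, hM p hp⟩, fun p hp => ?_⟩, hinv⟩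
  · rw [LinearIndependent.pair_iff, xu p hp, xv p hp]
    intro s t hst
    have r := hR p hp
    have e1 := congrArg (fun z => (inner ℝ z (X p) : ℝ)) hst
    have e2 := congrArg (fun z => (inner ℝ z (Y p) : ℝ)) hst
    simp only [inner_add_left, real_inner_smul_left, inner_zero_left, r.XX, r.YX, r.XY, r.YY]
      at e1 e2
    have hP0 := (hPpos p hp).ne'
    have hQ0 := (hQpos p hp).ne'
    simp_all
  · obtain ⟨i1, i2, i3, i4⟩ := hinv p hp
    rw [i1, i2, i3, i4]
    exact hstrong p hp

theorem IsBonnetData.exists_surface {D : Set (ℝ × ℝ)} {ν₁ ν₂ γ₁ γ₂ : ℝ × ℝ → ℝ}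
    (h : IsBonnetData D ν₁ ν₂ γ₁ γ₂) (hsc : IsSimplyConnected D) :
    ∃ x : ℝ × ℝ → E3, IsStronglyRegularSurface D x ∧ HasInvariants D x ν₁ ν₂ γ₁ γ₂ := by
  obtain ⟨p₀, hp₀⟩ := hsc.nonempty
  have hc : IsPreconnected D := hsc.isPathConnected.isConnected.isPreconnected
  have hE := h.contDiffOn_rootE
  have hG := h.contDiffOn_rootG
  obtain ⟨x, X, Y, l, hxs, hx, hF, h0⟩ := exists_position_and_frame h.isOpen hsc hE hG
    (h.smooth_γ₁.mul hE) (h.smooth_ν₁.mul hE) (h.smooth_γ₂.mul hG) (h.smooth_ν₂.mul hG)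
    (fun p hp => h.dv_rootE hp) (fun p hp => h.du_rootG hp) (fun p hp => h.gauss_frame hp)
    (fun p hp => h.dv_ν₁_mul_rootE hp) (fun p hp => h.du_ν₂_mul_rootG hp) hp₀
  refine ⟨x, isStronglyRegularSurface_of_frame h.isOpen hxs hE hG (fun p hp => h.rootE_pos hp)
    (fun p hp => h.rootG_pos hp) (fun p hp => h.dv_rootE hp) (fun p hp => h.du_rootG hp) hx hF
    (fun p hp => ?_) fun p hp =>
      mul_ne_zero (mul_ne_zero (h.sub_ne hp) (h.γ₁_ne hp)) (h.γ₂_ne hp)⟩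
  have := hF.orthonormal h.isOpen hc hp₀ h0 hp
  exact isRightFrame_of_frameMatrix this.1 this.2

end Realization

/-! ### The frame of a given surface, and uniqueness up to a motion. -/

section Uniqueness

open Set Filter Topology

theorem cross_inner_left (a b : E3) : (inner ℝ a (cross a b) : ℝ) = 0 := by
  simp [cross, crossProduct, PiLp.inner_apply, Fin.sum_univ_three]; ring

theorem cross_inner_right (a b : E3) : (inner ℝ b (cross a b) : ℝ) = 0 := by
  simp [cross, crossProduct, PiLp.inner_apply, Fin.sum_univ_three]; ring

theorem cross_inner_cross (a b : E3) : (inner ℝ (cross a b) (cross a b) : ℝ)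
    = inner ℝ a a * inner ℝ b b - (inner ℝ a b : ℝ) ^ 2 := by
  simp [cross, crossProduct, PiLp.inner_apply, Fin.sum_univ_three,
    -inner_self_eq_norm_sq_to_K]
  ring

theorem contDiffOn_cross {D : Set (ℝ × ℝ)} {f g : ℝ × ℝ → E3} (hf : ContDiffOn ℝ ∞ f D)
    (hg : ContDiffOn ℝ ∞ g D) : ContDiffOn ℝ ∞ (fun p => cross (f p) (g p)) D := by
  rw [contDiffOn_euclidean] at hf hg ⊢
  intro i
  have f0 := hf 0
  have f1 := hf 1
  have f2 := hf 2
  have g0 := hg 0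
  have g1 := hg 1
  have g2 := hg 2
  fin_cases i <;> simp only [cross, crossProduct, LinearMap.mk₂_apply, Fin.zero_eta, Fin.mk_one,
    Fin.reduceFinMk, Matrix.cons_val]
  · exact (f1.mul g2).sub (f2.mul g1)
  · exact (f2.mul g0).sub (f0.mul g2)
  · exact (f0.mul g1).sub (f1.mul g0)

/-- The moving frame of a surface with the given data. -/
theorem IsBonnetData.exists_frame {D : Set (ℝ × ℝ)} {ν₁ ν₂ γ₁ γ₂ : ℝ × ℝ → ℝ}
    (h : IsBonnetData D ν₁ ν₂ γ₁ γ₂) {x : ℝ × ℝ → E3} (hx : IsStronglyRegularSurface D x)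
    (hinv : HasInvariants D x ν₁ ν₂ γ₁ γ₂) :
    ∃ X Y l : ℝ × ℝ → E3,
      (∀ p ∈ D, HasFDerivAt x
        (pairCLM (rootE ν₁ ν₂ γ₂ p • X p) (rootG ν₁ ν₂ γ₁ p • Y p)) p) ∧
      IsFrameOn D (fun p => γ₁ p * rootE ν₁ ν₂ γ₂ p) (fun p => ν₁ p * rootE ν₁ ν₂ γ₂ p)
        (fun p => γ₂ p * rootG ν₁ ν₂ γ₁ p) (fun p => ν₂ p * rootG ν₁ ν₂ γ₁ p) X Y l ∧
      ∀ p ∈ D, IsRightFrame (X p) (Y p) (l p) := by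
  have hD := h.isOpen
  have sxu := contDiffOn_du hD hx.smooth
  have sxv := contDiffOn_dv hD hx.smooth
  have sE : ContDiffOn ℝ ∞ (formE x) D := sxu.inner ℝ sxu
  have sG : ContDiffOn ℝ ∞ (formG x) D := sxv.inner ℝ sxv
  have hEpos : ∀ p ∈ D, 0 < formE x p := fun p hp =>
    real_inner_self_pos.2 ((hx.regular p hp).ne_zero 0)
  have hGpos : ∀ p ∈ D, 0 < formG x p := fun p hp =>
    real_inner_self_pos.2 ((hx.regular p hp).ne_zero 1)
  obtain ⟨P, hPdef⟩ : ∃ P : ℝ × ℝ → ℝ, ∀ p, P p = √(formE x p) := ⟨_, fun _ => rfl⟩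
  obtain ⟨Q, hQdef⟩ : ∃ Q : ℝ × ℝ → ℝ, ∀ p, Q p = √(formG x p) := ⟨_, fun _ => rfl⟩
  have hPpos : ∀ p ∈ D, 0 < P p := fun p hp => by rw [hPdef]; exact Real.sqrt_pos.2 (hEpos p hp)
  have hQpos : ∀ p ∈ D, 0 < Q p := fun p hp => by rw [hQdef]; exact Real.sqrt_pos.2 (hGpos p hp)
  have hE : ∀ p ∈ D, formE x p = P p ^ 2 := fun p hp => by
    rw [hPdef, Real.sq_sqrt (hEpos p hp).le]
  have hG : ∀ p ∈ D, formG x p = Q p ^ 2 := fun p hp => by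
    rw [hQdef, Real.sq_sqrt (hGpos p hp).le]
  have sP : ContDiffOn ℝ ∞ P D := by
    rw [funext hPdef]; exact sE.sqrt fun p hp => (hEpos p hp).ne'
  have sQ : ContDiffOn ℝ ∞ Q D := by
    rw [funext hQdef]; exact sG.sqrt fun p hp => (hGpos p hp).ne'
  obtain ⟨X, hX⟩ : ∃ X : ℝ × ℝ → E3, ∀ p, X p = (P p)⁻¹ • du x p := ⟨_, fun _ => rfl⟩
  obtain ⟨Y, hY⟩ : ∃ Y : ℝ × ℝ → E3, ∀ p, Y p = (Q p)⁻¹ • dv x p := ⟨_, fun _ => rfl⟩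
  obtain ⟨l, hl⟩ : ∃ l : ℝ × ℝ → E3, ∀ p, l p = cross (X p) (Y p) := ⟨_, fun _ => rfl⟩
  have sX : ContDiffOn ℝ ∞ X D := by
    rw [funext hX]; exact (sP.inv fun p hp => (hPpos p hp).ne').smul sxu
  have sY : ContDiffOn ℝ ∞ Y D := by
    rw [funext hY]; exact (sQ.inv fun p hp => (hQpos p hp).ne').smul sxv
  have sl : ContDiffOn ℝ ∞ l D := by rw [funext hl]; exact contDiffOn_cross sX sY
  have xu : ∀ p ∈ D, du x p = P p • X p := fun p hp => by
    rw [hX, smul_smul, mul_inv_cancel₀ (hPpos p hp).ne', one_smul]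
  have xv : ∀ p ∈ D, dv x p = Q p • Y p := fun p hp => by
    rw [hY, smul_smul, mul_inv_cancel₀ (hQpos p hp).ne', one_smul]
  have hR : ∀ p ∈ D, IsRightFrame (X p) (Y p) (l p) := by
    intro p hp
    have hP0 := (hPpos p hp).ne'
    have hQ0 := (hQpos p hp).ne'
    have r1 : (inner ℝ (X p) (X p) : ℝ) = 1 := by
      have := hE p hp
      rw [formE] at this
      rw [hX, real_inner_smul_left, real_inner_smul_right, this]; field_simp
    have r2 : (inner ℝ (Y p) (Y p) : ℝ) = 1 := by
      have := hG p hp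
      rw [formG] at this
      rw [hY, real_inner_smul_left, real_inner_smul_right, this]; field_simp
    have r3 : (inner ℝ (X p) (Y p) : ℝ) = 0 := by
      have := (hx.principal p hp).1
      rw [formF] at this
      rw [hX, hY, real_inner_smul_left, real_inner_smul_right, this]; ring
    refine ⟨r1, r2, ?_, r3, ?_, ?_, (hl p).symm⟩
    · rw [hl, cross_inner_cross, r1, r2, r3]; norm_num
    · rw [hl, cross_inner_left]
    · rw [hl, cross_inner_right]
  have hn : ∀ p ∈ D, unitNormal x p = l p := by
    intro p hp
    have hPQ : 0 < P p * Q p := mul_pos (hPpos p hp) (hQpos p hp)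
    have hl1 : ‖l p‖ = 1 := by
      have := (hR p hp).ll
      rw [real_inner_self_eq_norm_sq] at this
      nlinarith [norm_nonneg (l p)]
    rw [unitNormal, xu p hp, xv p hp, cross_smul_smul, (hR p hp).cross_eq, norm_smul, hl1, mul_one,
      Real.norm_of_nonneg hPQ.le, smul_smul, inv_mul_cancel₀ hPQ.ne', one_smul]
  have dP := fun p (hp : p ∈ D) => differentiableAt_of_contDiffOn hD sP hp
  have dQ := fun p (hp : p ∈ D) => differentiableAt_of_contDiffOn hD sQ hp
  have dX := fun p (hp : p ∈ D) => differentiableAt_of_contDiffOn hD sX hp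
  have dY := fun p (hp : p ∈ D) => differentiableAt_of_contDiffOn hD sY hp
  have dl := fun p (hp : p ∈ D) => differentiableAt_of_contDiffOn hD sl hp
  -- Differentiating constant scalar products: the connection coefficients are antisymmetric, so
  -- only half of them need computing.
  have inner_u : ∀ {U W : ℝ × ℝ → E3} {k : ℝ}, ContDiffOn ℝ ∞ U D → ContDiffOn ℝ ∞ W D →
      (∀ p ∈ D, (inner ℝ (U p) (W p) : ℝ) = k) → ∀ p ∈ D,
      (inner ℝ (du U p) (W p) : ℝ) = -inner ℝ (du W p) (U p) := by
    intro U W k hU hW hk p hp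
    have e := du_inner (differentiableAt_of_contDiffOn hD hU hp)
      (differentiableAt_of_contDiffOn hD hW hp)
    rw [du_congr (g := fun _ => k) hD hk hp, real_inner_comm (du W p)] at e
    have : du (fun _ : ℝ × ℝ => k) p = 0 := by simp [du]
    linarith
  have inner_v : ∀ {U W : ℝ × ℝ → E3} {k : ℝ}, ContDiffOn ℝ ∞ U D → ContDiffOn ℝ ∞ W D →
      (∀ p ∈ D, (inner ℝ (U p) (W p) : ℝ) = k) → ∀ p ∈ D,
      (inner ℝ (dv U p) (W p) : ℝ) = -inner ℝ (dv W p) (U p) := by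
    intro U W k hU hW hk p hp
    have e := dv_inner (differentiableAt_of_contDiffOn hD hU hp)
      (differentiableAt_of_contDiffOn hD hW hp)
    rw [dv_congr (g := fun _ => k) hD hk hp, real_inner_comm (dv W p)] at e
    have : dv (fun _ : ℝ × ℝ => k) p = 0 := by simp [dv]
    linarith
  have xuu : ∀ p ∈ D, du (du x) p = du P p • X p + P p • du X p := fun p hp => by
    rw [du_congr hD xu hp, du_smul (dP p hp) (dX p hp)]
  have xuv : ∀ p ∈ D, dv (du x) p = dv P p • X p + P p • dv X p := fun p hp => by
    rw [dv_congr hD xu hp, dv_smul (dP p hp) (dX p hp)]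
  -- A second expression for `x_uv`, by symmetry of mixed derivatives. Compared with `xuv` along `Y`
  -- and `X` it gives `c1` and `c2`; with `M = 0`, the two expressions give `c5` and `c6`.
  have xvu : ∀ p ∈ D, dv (du x) p = du Q p • Y p + Q p • du Y p := fun p hp => by
    rw [dv_du_eq_du_dv hD hx.smooth hp, du_congr hD xv hp, du_smul (dQ p hp) (dY p hp)]
  have xvv : ∀ p ∈ D, dv (dv x) p = dv Q p • Y p + Q p • dv Y p := fun p hp => by
    rw [dv_congr hD xv hp, dv_smul (dQ p hp) (dY p hp)]
  have rXX := fun p (hp : p ∈ D) => (hR p hp).XX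
  have rYY := fun p (hp : p ∈ D) => (hR p hp).YY
  have rll := fun p (hp : p ∈ D) => (hR p hp).ll
  have rXY := fun p (hp : p ∈ D) => (hR p hp).XY
  have rXl := fun p (hp : p ∈ D) => (hR p hp).Xl
  have rYl := fun p (hp : p ∈ D) => (hR p hp).Yl
  have hM : ∀ p ∈ D, (inner ℝ (dv (du x) p) (l p) : ℝ) = 0 := fun p hp => by
    rw [← hn p hp]; exact (hx.principal p hp).2
  -- the derivatives of `P` and `Q`
  have hPv : ∀ p ∈ D, dv P p = -(Q p * (γ₁ p * P p)) := by
    intro p hp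
    have hP0 := (hPpos p hp).ne'
    have hQ0 := (hQpos p hp).ne'
    have e := (hinv p hp).2.2.1
    rw [gamma1, dv_congr hD hE hp, dv_sq (dP p hp), ← hQdef, hE p hp] at e
    rw [← e]; field_simp
  have hQu : ∀ p ∈ D, du Q p = P p * (γ₂ p * Q p) := by
    intro p hp
    have hP0 := (hPpos p hp).ne'
    have hQ0 := (hQpos p hp).ne'
    have e := (hinv p hp).2.2.2
    rw [gamma2, du_congr hD hG hp, du_sq (dQ p hp), ← hPdef, hG p hp] at e
    rw [← e]; field_simp
  -- the connection coefficients
  have c1 : ∀ p ∈ D, (inner ℝ (dv X p) (Y p) : ℝ) = γ₂ p * Q p := by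
    intro p hp
    have r := hR p hp
    have e := congrArg (fun z => (inner ℝ z (Y p) : ℝ)) ((xuv p hp).symm.trans (xvu p hp))
    have e0 := inner_u sY sY rYY p hp
    have e1 : (inner ℝ (du Y p) (Y p) : ℝ) = 0 := by linarith
    simp only [inner_add_left, real_inner_smul_left, r.XY, r.YY, e1, hQu p hp] at e
    apply mul_left_cancel₀ (hPpos p hp).ne'
    linarith
  have c2 : ∀ p ∈ D, (inner ℝ (du X p) (Y p) : ℝ) = γ₁ p * P p := by
    intro p hp
    have r := hR p hp
    have e := congrArg (fun z => (inner ℝ z (X p) : ℝ)) ((xuv p hp).symm.trans (xvu p hp))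
    have e0 := inner_v sX sX rXX p hp
    have e1 : (inner ℝ (dv X p) (X p) : ℝ) = 0 := by linarith
    simp only [inner_add_left, real_inner_smul_left, r.XX, r.YX, e1, hPv p hp] at e
    rw [inner_u sX sY rXY p hp]
    apply mul_left_cancel₀ (hQpos p hp).ne'
    linarith
  have c3 : ∀ p ∈ D, (inner ℝ (du X p) (l p) : ℝ) = ν₁ p * P p := by
    intro p hp
    have r := hR p hp
    have hP0 := (hPpos p hp).ne'
    have e := (hinv p hp).1
    rw [nu1, formL, hn p hp, hE p hp, xuu p hp, inner_add_left, real_inner_smul_left,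
      real_inner_smul_left, r.Xl] at e
    rw [← e]; field_simp; ring
  have c4 : ∀ p ∈ D, (inner ℝ (dv Y p) (l p) : ℝ) = ν₂ p * Q p := by
    intro p hp
    have r := hR p hp
    have hQ0 := (hQpos p hp).ne'
    have e := (hinv p hp).2.1
    rw [nu2, formN, hn p hp, hG p hp, xvv p hp, inner_add_left, real_inner_smul_left,
      real_inner_smul_left, r.Yl] at e
    rw [← e]; field_simp; ring
  have c5 : ∀ p ∈ D, (inner ℝ (dv X p) (l p) : ℝ) = 0 := by
    intro p hp
    have r := hR p hp
    have e := hM p hp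
    rw [xuv p hp, inner_add_left, real_inner_smul_left, real_inner_smul_left, r.Xl] at e
    apply mul_left_cancel₀ (hPpos p hp).ne'
    linarith
  have c6 : ∀ p ∈ D, (inner ℝ (du Y p) (l p) : ℝ) = 0 := by
    intro p hp
    have r := hR p hp
    have e := hM p hp
    rw [xvu p hp, inner_add_left, real_inner_smul_left, real_inner_smul_left, r.Yl] at e
    apply mul_left_cancel₀ (hQpos p hp).ne'
    linarith
  have s0 : ∀ t : ℝ, t = -t → t = 0 := fun t ht => by linarith
  have hF : IsFrameOn D (fun p => γ₁ p * P p) (fun p => ν₁ p * P p) (fun p => γ₂ p * Q p)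
      (fun p => ν₂ p * Q p) X Y l := by
    refine ⟨fun p hp => ?_, fun p hp => ?_, fun p hp => ?_⟩
    · have e1 := (hR p hp).expand (du X p)
      have e2 := (hR p hp).expand (dv X p)
      rw [s0 _ (inner_u sX sX rXX p hp), c2 p hp, c3 p hp] at e1
      rw [s0 _ (inner_v sX sX rXX p hp), c1 p hp, c5 p hp] at e2
      have := hasFDerivAt_pairCLM (dX p hp)
      rw [e1, e2] at this
      simpa using this
    · have e1 := (hR p hp).expand (du Y p)
      have e2 := (hR p hp).expand (dv Y p)
      rw [s0 _ (inner_u sY sY rYY p hp), inner_u sY sX (fun p hp => (hR p hp).YX) p hp, c2 p hp,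
        c6 p hp] at e1
      rw [s0 _ (inner_v sY sY rYY p hp), inner_v sY sX (fun p hp => (hR p hp).YX) p hp, c1 p hp,
        c4 p hp] at e2
      have := hasFDerivAt_pairCLM (dY p hp)
      rw [e1, e2] at this
      simpa using this
    · have e1 := (hR p hp).expand (du l p)
      have e2 := (hR p hp).expand (dv l p)
      rw [s0 _ (inner_u sl sl rll p hp), inner_u sl sX (fun p hp => (hR p hp).lX) p hp,
        inner_u sl sY (fun p hp => (hR p hp).lY) p hp, c3 p hp, c6 p hp] at e1
      rw [s0 _ (inner_v sl sl rll p hp), inner_v sl sX (fun p hp => (hR p hp).lX) p hp,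
        inner_v sl sY (fun p hp => (hR p hp).lY) p hp, c5 p hp, c4 p hp] at e2
      have := hasFDerivAt_pairCLM (dl p hp)
      rw [e1, e2] at this
      simpa using this
  -- the Codazzi equations
  have lu : ∀ p ∈ D, du l p = (-(ν₁ p * P p)) • X p := fun p hp => by
    rw [du_eq_of_hasFDerivAt (hF.deriv_l p hp), neg_smul]
  have lv : ∀ p ∈ D, dv l p = (-(ν₂ p * Q p)) • Y p := fun p hp => by
    rw [dv_eq_of_hasFDerivAt (hF.deriv_l p hp), neg_smul]
  have d1 := fun p (hp : p ∈ D) => differentiableAt_of_contDiffOn hD h.smooth_ν₁ hp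
  have d2 := fun p (hp : p ∈ D) => differentiableAt_of_contDiffOn hD h.smooth_ν₂ hp
  -- This is `l_uv = l_vu`; its `X` and `Y` components yield the two Codazzi equations `nv` and
  -- `nu`.
  have hcod : ∀ p ∈ D,
      dv (fun q => -(ν₁ q * P q)) p • X p + (-(ν₁ p * P p)) • ((γ₂ p * Q p) • Y p)
      = du (fun q => -(ν₂ q * Q q)) p • Y p + (-(ν₂ p * Q p)) • (-((γ₁ p * P p) • X p)) := by
    intro p hp
    have e := dv_du_eq_du_dv hD sl hp
    rw [dv_congr hD lu hp, du_congr hD lv hp,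
      dv_smul ((d1 p hp).fun_mul (dP p hp)).fun_neg (dX p hp),
      du_smul ((d2 p hp).fun_mul (dQ p hp)).fun_neg (dY p hp),
      dv_eq_of_hasFDerivAt (hF.deriv_X p hp), du_eq_of_hasFDerivAt (hF.deriv_Y p hp)] at e
    exact e
  have nv : ∀ p ∈ D, dv ν₁ p = γ₁ p * Q p * (ν₁ p - ν₂ p) := by
    intro p hp
    have r := hR p hp
    have e := congrArg (fun z => (inner ℝ z (X p) : ℝ)) (hcod p hp)
    have e1 : dv (fun q => -(ν₁ q * P q)) p = -(dv ν₁ p * P p + ν₁ p * dv P p) := by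
      rw [← dv_mul (d1 p hp) (dP p hp)]; simp [dv, fderiv_fun_neg]
    simp only [inner_add_left, inner_neg_left, real_inner_smul_left, r.XX, r.YX, e1,
      hPv p hp] at e
    apply mul_right_cancel₀ (hPpos p hp).ne'
    linarith
  have nu : ∀ p ∈ D, du ν₂ p = γ₂ p * P p * (ν₁ p - ν₂ p) := by
    intro p hp
    have r := hR p hp
    have e := congrArg (fun z => (inner ℝ z (Y p) : ℝ)) (hcod p hp)
    have e1 : du (fun q => -(ν₂ q * Q q)) p = -(du ν₂ p * Q p + ν₂ p * du Q p) := by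
      rw [← du_mul (d2 p hp) (dQ p hp)]; simp [du, fderiv_fun_neg]
    simp only [inner_add_left, inner_neg_left, real_inner_smul_left, r.XY, r.YY, e1,
      hQu p hp] at e
    apply mul_right_cancel₀ (hQpos p hp).ne'
    linarith
  -- The Codazzi equations solved for `√E` and `√G`: the metric depends on the invariants alone.
  have hPE : ∀ p ∈ D, rootE ν₁ ν₂ γ₂ p = P p := by
    intro p hp
    have := h.γ₂_ne hp
    have := h.sub_ne hp
    rw [rootE, nu p hp]; field_simp
  have hQG : ∀ p ∈ D, rootG ν₁ ν₂ γ₁ p = Q p := by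
    intro p hp
    have := h.γ₁_ne hp
    have := h.sub_ne hp
    rw [rootG, nv p hp]; field_simp
  refine ⟨X, Y, l, fun p hp => ?_, ⟨fun p hp => ?_, fun p hp => ?_, fun p hp => ?_⟩, hR⟩
  · rw [hPE p hp, hQG p hp, ← xu p hp, ← xv p hp]
    exact hasFDerivAt_pairCLM (differentiableAt_of_contDiffOn hD hx.smooth hp)
  · simpa only [hPE p hp, hQG p hp] using hF.deriv_X p hp
  · simpa only [hPE p hp, hQG p hp] using hF.deriv_Y p hp
  · simpa only [hPE p hp, hQG p hp] using hF.deriv_l p hp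

/-- With `C = Rᵀ R'`, which is constant, `R' = R C`; as the frame vectors are rows, `X' = Cᵀ X` and
`Y' = Cᵀ Y`. So `y - Cᵀ x` has zero derivative, the factors `P` and `Q` being common to both
surfaces. -/
theorem IsBonnetData.exists_motion {D : Set (ℝ × ℝ)} {ν₁ ν₂ γ₁ γ₂ : ℝ × ℝ → ℝ}
    (h : IsBonnetData D ν₁ ν₂ γ₁ γ₂) (hc : IsConnected D) {x y : ℝ × ℝ → E3}
    (hx : IsStronglyRegularSurface D x) (hxi : HasInvariants D x ν₁ ν₂ γ₁ γ₂)
    (hy : IsStronglyRegularSurface D y) (hyi : HasInvariants D y ν₁ ν₂ γ₁ γ₂) :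
    ∃ g : E3 → E3, IsMotion g ∧ ∀ p ∈ D, y p = g (x p) := by
  obtain ⟨X, Y, l, hdx, hF, hR⟩ := h.exists_frame hx hxi
  obtain ⟨X', Y', l', hdy, hF', hR'⟩ := h.exists_frame hy hyi
  obtain ⟨p₀, hp₀⟩ := hc.nonempty
  obtain ⟨C, hC⟩ : ∃ C : Matrix (Fin 3) (Fin 3) ℝ, C =
    (frameMatrix (X p₀) (Y p₀) (l p₀)).transpose * frameMatrix (X' p₀) (Y' p₀) (l' p₀) := ⟨_, rfl⟩
  have hRC : ∀ p ∈ D, frameMatrix (X' p) (Y' p) (l' p) = frameMatrix (X p) (Y p) (l p) * C := by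
    intro p hp
    rw [hC, hF.transpose_mul_const h.isOpen hc.isPreconnected hF' hp₀ hp, ← Matrix.mul_assoc,
      (hR p hp).mul_transpose, one_mul]
  have hSO : C.transpose ∈ Matrix.specialOrthogonalGroup (Fin 3) ℝ := by
    rw [Matrix.mem_specialOrthogonalGroup_iff, Matrix.mem_orthogonalGroup_iff]
    constructor
    · have h1 := (hR p₀ hp₀).mul_transpose
      have h2 : (frameMatrix (X' p₀) (Y' p₀) (l' p₀)).transpose
        * frameMatrix (X' p₀) (Y' p₀) (l' p₀) = 1 := mul_eq_one_comm.1 (hR' p₀ hp₀).mul_transpose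
      have h3 := congrArg Matrix.transpose (hRC p₀ hp₀)
      rw [Matrix.transpose_mul] at h3
      rw [Matrix.transpose_transpose]
      rw [h3, hRC p₀ hp₀, Matrix.mul_assoc, ← Matrix.mul_assoc _ _ C,
        mul_eq_one_comm.1 h1, one_mul] at h2
      exact h2
    · rw [Matrix.det_transpose, hC, Matrix.det_mul, Matrix.det_transpose, (hR p₀ hp₀).det,
        (hR' p₀ hp₀).det, one_mul]
  have hX' : ∀ p ∈ D, ∀ k, X' p k = X p 0 * C 0 k + X p 1 * C 1 k + X p 2 * C 2 k := by
    intro p hp k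
    have := congrFun (congrFun (hRC p hp) 0) k
    simpa [frameMatrix, Matrix.mul_apply, Fin.sum_univ_three] using this
  have hY' : ∀ p ∈ D, ∀ k, Y' p k = Y p 0 * C 0 k + Y p 1 * C 1 k + Y p 2 * C 2 k := by
    intro p hp k
    have := congrFun (congrFun (hRC p hp) 1) k
    simpa [frameMatrix, Matrix.mul_apply, Fin.sum_univ_three] using this
  have hconst : ∀ k, ∀ p ∈ D,
      y p k - (x p 0 * C 0 k + x p 1 * C 1 k + x p 2 * C 2 k)
      = y p₀ k - (x p₀ 0 * C 0 k + x p₀ 1 * C 1 k + x p₀ 2 * C 2 k) := by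
    intro k p hp
    have hd : ∀ r ∈ D, HasFDerivAt
        (fun r => y r k - (x r 0 * C 0 k + x r 1 * C 1 k + x r 2 * C 2 k))
        (0 : ℝ × ℝ →L[ℝ] ℝ) r := by
      intro r hr
      have e0 := (hasFDerivAt_coord (hdx r hr) 0).mul_const (C 0 k)
      have e1 := (hasFDerivAt_coord (hdx r hr) 1).mul_const (C 1 k)
      have e2 := (hasFDerivAt_coord (hdx r hr) 2).mul_const (C 2 k)
      refine ((hasFDerivAt_coord (hdy r hr) k).fun_sub ((e0.fun_add e1).fun_add e2)).congr_fderiv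
        ?_
      ext <;> simp [hX' r hr, hY' r hr] <;> ring
    exact h.isOpen.is_const_of_fderiv_eq_zero hc.isPreconnected
      (fun r hr => (hd r hr).differentiableAt.differentiableWithinAt)
      (fun r hr => (hd r hr).fderiv) hp hp₀
  refine ⟨fun z => WithLp.toLp 2 (C.transpose.mulVec z.ofLp)
    + (y p₀ - WithLp.toLp 2 (C.transpose.mulVec (x p₀).ofLp)),
    ⟨C.transpose, hSO, _, fun _ => rfl⟩, fun p hp => ?_⟩
  ext k
  have := hconst k p hp
  simp [Matrix.mulVec, dotProduct, Fin.sum_univ_three]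
  linarith

end Uniqueness

end Surf

/-! ### The three assertions assembled. -/

theorem theorem3p2
    (D : Set (ℝ × ℝ)) (hD : IsOpen D)
    (ν₁ ν₂ γ₁ γ₂ : ℝ × ℝ → ℝ)
    (hν₁ : ContDiffOn ℝ ∞ ν₁ D) (hν₂ : ContDiffOn ℝ ∞ ν₂ D)
    (hγ₁ : ContDiffOn ℝ ∞ γ₁ D) (hγ₂ : ContDiffOn ℝ ∞ γ₂ D)
    -- sign conditions
    (hpos : ∀ p ∈ D, 0 < ν₁ p - ν₂ p ∧ 0 < γ₁ p * Surf.dv ν₁ p ∧ 0 < γ₂ p * Surf.du ν₂ p)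
    -- the Codazzi type equations
    (hcod₁ : ∀ p ∈ D,
      Surf.du (fun q => Real.log (Surf.dv ν₁ q / γ₁ q)) p = Surf.du ν₁ p / (ν₁ p - ν₂ p))
    (hcod₂ : ∀ p ∈ D,
      Surf.dv (fun q => Real.log (Surf.du ν₂ q / γ₂ q)) p = -(Surf.dv ν₂ p / (ν₁ p - ν₂ p)))
    -- the Gauss type equation
    (hgauss : ∀ p ∈ D,
      (ν₁ p - ν₂ p) / 2 *
          (Surf.dv (fun q => γ₁ q ^ 2) p / Surf.dv ν₁ p -
            Surf.du (fun q => γ₂ q ^ 2) p / Surf.du ν₂ p) -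
        (γ₁ p ^ 2 + γ₂ p ^ 2) = ν₁ p * ν₂ p) :
    -- existence near every point of `D`
    (∀ p₀ ∈ D, ∃ D₀ : Set (ℝ × ℝ), IsOpen D₀ ∧ IsConnected D₀ ∧ p₀ ∈ D₀ ∧ D₀ ⊆ D ∧
      ∃ x : ℝ × ℝ → Surf.E3,
        Surf.IsStronglyRegularSurface D₀ x ∧ Surf.HasInvariants D₀ x ν₁ ν₂ γ₁ γ₂) ∧
    -- existence on the whole of `D` if `D` is simply connected
    (IsSimplyConnected D → ∃ x : ℝ × ℝ → Surf.E3,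
      Surf.IsStronglyRegularSurface D x ∧ Surf.HasInvariants D x ν₁ ν₂ γ₁ γ₂) ∧
    -- uniqueness up to a motion over every connected open part of `D`
    (∀ D₀ : Set (ℝ × ℝ), IsOpen D₀ → IsConnected D₀ → D₀ ⊆ D →
      ∀ x y : ℝ × ℝ → Surf.E3,
        Surf.IsStronglyRegularSurface D₀ x → Surf.HasInvariants D₀ x ν₁ ν₂ γ₁ γ₂ →
        Surf.IsStronglyRegularSurface D₀ y → Surf.HasInvariants D₀ y ν₁ ν₂ γ₁ γ₂ →
        ∃ g : Surf.E3 → Surf.E3, Surf.IsMotion g ∧ ∀ p ∈ D₀, y p = g (x p)) := by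
  have h : Surf.IsBonnetData D ν₁ ν₂ γ₁ γ₂ :=
    ⟨hD, hν₁, hν₂, hγ₁, hγ₂, hpos, hcod₁, hcod₂, hgauss⟩
  refine ⟨fun p₀ hp₀ => ?_, fun hsc => h.exists_surface hsc,
    fun D₀ hD₀ hc hsub x y hx hxi hy hyi => (h.mono hD₀ hsub).exists_motion hc hx hxi hy hyi⟩
  -- Local existence is the global statement on a ball, which is convex, hence simply connected.
  obtain ⟨ρ, hρ, hball⟩ := Metric.isOpen_iff.1 hD p₀ hp₀
  have : ContractibleSpace (Metric.ball p₀ ρ) :=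
    (convex_ball p₀ ρ).contractibleSpace ⟨p₀, Metric.mem_ball_self hρ⟩
  have hsc : IsSimplyConnected (Metric.ball p₀ ρ) :=
    inferInstanceAs (SimplyConnectedSpace (Metric.ball p₀ ρ))
  exact ⟨Metric.ball p₀ ρ, Metric.isOpen_ball, hsc.isPathConnected.isConnected,
    Metric.mem_ball_self hρ, hball, (h.mono Metric.isOpen_ball hball).exists_surface hsc⟩
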